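/- Let $x_1<x_2$, $0<\tau_1<\tau_2$, $(a_0,a_1)\in\mathbb R\times(-\infty,0)$ and $\beta\ge 0$. For a parameter $(a_0,a_1)$ put $\lambda_i=\exp(a_0+a_1x_i)$ ($i=1,2$), $\boldsymbol\lambda=(\lambda_1,\lambda_2)$, $h=\frac{\lambda_2}{\lambda_1}\tau_1-\tau_1$, $$f_1(t|\lambda_1)=\tfrac1{\lambda_1}e^{-t/\lambda_1},\qquad f_2(t+h|\boldsymbol\lambda)=\tfrac1{\lambda_2}e^{-(t+h)/\lambda_2},\qquad F_2(t+h|\boldsymbol\lambda)=1-e^{-(t+h)/\lambda_2}.$$ In the simple step-stress test (cumulative exposure model, exponential lifetimes), the lifetimes $T_1,T_2,\dots$ are i.i.d. with density $f_1(t|\lambda_1)$ for $0\le t<\tau_1$ and $f_2(t+h|\boldsymbol\lambda)$ for $t\ge\tau_1$, where $(a_0,a_1)$ is the true parameter; they are Type-I censored at $\tau_2$. Among the first $N$ units let $n_1$ be the number with $T_i<\tau_1$ and $n_2$ the number with $\tau_1\le T_i<\tau_2$. For $\beta>0$ the minimum density power divergence estimator (MDPDE) $(\hat a_0^\beta,\hat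 a_1^\beta)$ is a (measurable) minimizer over $\mathbb R\times(-\infty,0)$ of $$H_N^\beta=\int_0^{\tau_1}f_1(t|\lambda_1)^{\beta+1}dt+\int_{\tau_1}^{\tau_2}f_2(t+h|\boldsymbol\lambda)^{\beta+1}dt+\bigl(1-F_2(\tau_2+h|\boldsymbol\lambda)\bigr)^{\beta+1}$$ $$-\frac{\beta+1}{\beta N}\Bigl\{\sum_{T_i<\tau_1}f_1(T_i|\lambda_1)^\beta+\sum_{\tau_1\le T_i<\tau_2}f_2(T_i+h|\boldsymbol\lambda)^\beta+(N-n_1-n_2)\bigl(1-F_2(\tau_2+h|\boldsymbol\lambda)\bigr)^\beta\Bigr\},$$ and for $\beta=0$ it is the maximum likelihood estimator, i.e. a maximizer over the same set of $\sum_{T_i<\tau_1}\log f_1(T_i|\lambda_1)+\sum_{\tau_1\le T_i<\tau_2}\log f_2(T_i+h|\boldsymbol\lambda)+(N-n_1-n_2)\log(1-F_2(\tau_2+h|\boldsymbol\lambda))$. Whenever an optimizer exists the estimator is one of them; on samples without an optimizer its value is arbitrary. Then, with all quantities below evaluated at the true $(a_0,a_1)$, the matrix $\boldsymbol J_\beta$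 is invertible, $\boldsymbol J_\beta^{-1}\boldsymbol K_\beta\boldsymbol J_\beta^{-1}$ is positive semidefinite, and $$\sqrt N\bigl((\hat a_0^\beta,\hat a_1^\beta)^\top-(a_0,a_1)^\top\bigr)\xrightarrow[N\to\infty]{\mathscr L}\mathcal N\bigl(0,\boldsymbol J_\beta^{-1}\boldsymbol K_\beta\boldsymbol J_\beta^{-1}\bigr).$$ Here, with $$L=-1-\tfrac{\tau_1}{\lambda_2}+\tfrac{\tau_1}{\lambda_1},\quad L^*=-x_2-\tfrac{\tau_1}{\lambda_2}x_2+\tfrac{\tau_1}{\lambda_1}x_1,\quad S=\tfrac{\tau_2+h}{\lambda_2},\quad S^*=\tfrac{\tau_2}{\lambda_2}x_2+\tfrac{\tau_1}{\lambda_1}x_1-\tfrac{\tau_1}{\lambda_2}x_2,$$ $c=\beta+1$, $u_1=\frac{\tau_1}{\lambda_1}c$, $v_i=\frac{\tau_i}{\lambda_2}c$, and $$M_0=\frac{e^{-hc/\lambda_2}}{\lambda_2^\beta c}\,(e^{-v_1}-e^{-v_2}),\qquad M_1=\frac{e^{-hc/\lambda_2}}{\lambda_2^\beta c^2}\,\bigl(e^{-v_1}(v_1+1)-e^{-v_2}(v_2+1)\bigr),$$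 $$M_2=\frac{e^{-hc/\lambda_2}}{\lambda_2^\beta c^3}\,\bigl(e^{-v_1}(v_1^2+2v_1+2)-e^{-v_2}(v_2^2+2v_2+2)\bigr),$$ $$Q=\frac1{\lambda_1^\beta c}\Bigl(e^{-u_1}\bigl(-1-\tfrac1{c^2}(u_1^2+2u_1+2)+\tfrac2c(u_1+1)\bigr)+1+\tfrac2{c^2}-\tfrac2c\Bigr),$$ $$q=-\frac1{\lambda_1^\beta c}(1-e^{-u_1})+\frac1{\lambda_1^\beta c^2}\bigl(1-e^{-u_1}(u_1+1)\bigr),$$ the matrices are $$\boldsymbol J_\beta=\begin{pmatrix}J_\beta(a_0)&J_\beta(a_0,a_1)\\J_\beta(a_0,a_1)&J_\beta(a_1)\end{pmatrix},\qquad \boldsymbol K_\beta=\boldsymbol J_{2\beta}-\boldsymbol\xi_\beta^\top\boldsymbol\xi_\beta,\qquad \boldsymbol\xi_\beta=(\xi_\beta(a_0),\xi_\beta(a_1)),$$ where $\boldsymbol J_{2\beta}$ is $\boldsymbol J_\beta$ with $\beta$ replaced by $2\beta$ and $$J_\beta(a_0)=Q+L^2M_0+M_2+2LM_1+S^2e^{-Sc},$$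 $$J_\beta(a_1)=x_1^2Q+(L^*)^2M_0+x_2^2M_2+2L^*x_2M_1+(S^*)^2e^{-Sc},$$ $$J_\beta(a_0,a_1)=x_1Q+L^*L\,M_0+x_2M_2+(L^*+x_2L)M_1+S^*S\,e^{-Sc},$$ $$\xi_\beta(a_0)=q+LM_0+M_1+Se^{-Sc},\qquad \xi_\beta(a_1)=x_1q+L^*M_0+x_2M_1+S^*e^{-Sc}.$$ -/

import Mathlib

open MeasureTheory ProbabilityTheory Filter

noncomputable section

namespace SSALT

/-- Data of a simple (two-level) step-stress accelerated life test: stress `x₁` on `(0, τ₁)`,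
stress `x₂` on `(τ₁, τ₂)`, and end of the experiment (Type-I censoring) at time `τ₂`. -/
structure Design where
  x₁ : ℝ
  x₂ : ℝ
  τ₁ : ℝ
  τ₂ : ℝ

variable (D : Design)

/-- The parameter vector `(a₀, a₁)` lives in the Euclidean plane. -/
abbrev Param : Type := EuclideanSpace ℝ (Fin 2)

/-- `λ₁ = exp (a₀ + a₁ x₁)`. -/
def scale₁ (a : Param) : ℝ := Real.exp (a 0 + a 1 * D.x₁)

/-- `λ₂ = exp (a₀ + a₁ x₂)`. -/
def scale₂ (a : Param) : ℝ := Real.exp (a 0 + a 1 * D.x₂)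

/-- The shifting time `h = (λ₂ / λ₁) τ₁ - τ₁` of the cumulative exposure model. -/
def shift (a : Param) : ℝ := scale₂ D a / scale₁ D a * D.τ₁ - D.τ₁

/-- Density of the lifetime under the first stress: `f₁(t|λ₁) = λ₁⁻¹ exp (-t/λ₁)`. -/
def f₁ (a : Param) (t : ℝ) : ℝ := 1 / scale₁ D a * Real.exp (-(t / scale₁ D a))

/-- Density of the lifetime under the second stress, at the (unshifted) time `t`:
`f₂(t+h|λ) = λ₂⁻¹ exp (-(t+h)/λ₂)`. -/
def f₂ (a : Param) (t : ℝ) : ℝ :=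
  1 / scale₂ D a * Real.exp (-((t + shift D a) / scale₂ D a))

/-- Distribution function of the lifetime under the second stress, at the (unshifted) time `t`:
`F₂(t+h|λ) = 1 - exp (-(t+h)/λ₂)`. -/
def F₂ (a : Param) (t : ℝ) : ℝ := 1 - Real.exp (-((t + shift D a) / scale₂ D a))

/-- Density of the lifetime in the cumulative exposure model. -/
def lifetimePDF (a : Param) (t : ℝ) : ℝ :=
  if t < 0 then 0 else if t < D.τ₁ then f₁ D a t else f₂ D a t

/-- Law of the lifetime in the cumulative exposure model. -/
def lifetimeLaw (a : Param) : Measure ℝ :=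
  volume.withDensity fun t => ENNReal.ofReal (lifetimePDF D a t)

/-- Among the first `N` units, those that fail under the first stress. -/
def failed₁ (N : ℕ) (t : ℕ → ℝ) : Finset ℕ := {i ∈ Finset.range N | t i < D.τ₁}

/-- Among the first `N` units, those that fail under the second stress before the end of the
experiment. -/
def failed₂ (N : ℕ) (t : ℕ → ℝ) : Finset ℕ :=
  {i ∈ Finset.range N | D.τ₁ ≤ t i ∧ t i < D.τ₂}

/-- Number `N - n₁ - n₂` of units surviving the experiment. -/
def survivors (N : ℕ) (t : ℕ → ℝ) : ℝ :=
  (N : ℝ) - (failed₁ D N t).card - (failed₂ D N t).card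

/-- The loss `H_N^β` of the minimum density power divergence estimator for `β > 0`. It depends on
the lifetimes only through the Type-I censored data. -/
def lossDPD (β : ℝ) (N : ℕ) (t : ℕ → ℝ) (a : Param) : ℝ :=
  (∫ s in (0 : ℝ)..D.τ₁, f₁ D a s ^ (β + 1)) + (∫ s in D.τ₁..D.τ₂, f₂ D a s ^ (β + 1))
    + (1 - F₂ D a D.τ₂) ^ (β + 1)
    - (β + 1) / (β * N) *
      ((∑ i ∈ failed₁ D N t, f₁ D a (t i) ^ β) + (∑ i ∈ failed₂ D N t, f₂ D a (t i) ^ β)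
        + survivors D N t * (1 - F₂ D a D.τ₂) ^ β)

/-- The log-likelihood, up to the additive constant `log (N! / (N - n₁ - n₂)!)`. -/
def logLik (N : ℕ) (t : ℕ → ℝ) (a : Param) : ℝ :=
  (∑ i ∈ failed₁ D N t, Real.log (f₁ D a (t i)))
    + (∑ i ∈ failed₂ D N t, Real.log (f₂ D a (t i)))
    + survivors D N t * Real.log (1 - F₂ D a D.τ₂)

/-- The loss function for `β ≥ 0`; at `β = 0` the estimator is the maximum likelihood
estimator. -/
def loss (β : ℝ) (N : ℕ) (t : ℕ → ℝ) (a : Param) : ℝ :=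
  if β = 0 then -logLik D N t a else lossDPD D β N t a

/-- The set of minimizers of the loss over the parameter space `ℝ × (-∞, 0)`. -/
def minimizers (β : ℝ) (N : ℕ) (t : ℕ → ℝ) : Set Param :=
  {a | a 1 < 0 ∧ ∀ b : Param, b 1 < 0 → loss D β N t a ≤ loss D β N t b}

/-- `est N` is, for every sample size `N`, a minimum density power divergence estimator with tuning
parameter `β` based on the lifetimes `T 0, …, T (N - 1)`: almost surely, whenever the loss has a
minimizer, `est N` is one. -/
def IsMDPDE {Ω : Type*} [MeasurableSpace Ω] (P : Measure Ω) (β : ℝ) (T : ℕ → Ω → ℝ)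
    (est : ℕ → Ω → Param) : Prop :=
  ∀ N, AEMeasurable (est N) P ∧
    ∀ᵐ ω ∂P, (minimizers D β N fun i => T i ω).Nonempty →
      est N ω ∈ minimizers D β N fun i => T i ω

/-! ### The asymptotic covariance matrix -/

/-- `L = -1 - τ₁/λ₂ + τ₁/λ₁`. -/
def L (a : Param) : ℝ := -1 - D.τ₁ / scale₂ D a + D.τ₁ / scale₁ D a

/-- `L* = -x₂ - (τ₁/λ₂) x₂ + (τ₁/λ₁) x₁`. -/
def Lstar (a : Param) : ℝ :=
  -D.x₂ - D.τ₁ / scale₂ D a * D.x₂ + D.τ₁ / scale₁ D a * D.x₁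

/-- `(τ₂ + h)/λ₂`. -/
def S (a : Param) : ℝ := (D.τ₂ + shift D a) / scale₂ D a

/-- `(τ₂/λ₂) x₂ + (τ₁/λ₁) x₁ - (τ₁/λ₂) x₂`. -/
def Sstar (a : Param) : ℝ :=
  D.τ₂ / scale₂ D a * D.x₂ + D.τ₁ / scale₁ D a * D.x₁ - D.τ₁ / scale₂ D a * D.x₂

/-- The common factor of the terms of the second stress level that are constant in `t`. -/
def M₀ (β : ℝ) (a : Param) : ℝ :=
  1 / (scale₂ D a ^ β * (β + 1)) * Real.exp (-(shift D a / scale₂ D a * (β + 1))) *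
    (Real.exp (-(D.τ₁ / scale₂ D a * (β + 1))) - Real.exp (-(D.τ₂ / scale₂ D a * (β + 1))))

/-- The common factor of the terms of the second stress level that are linear in `t`. -/
def M₁ (β : ℝ) (a : Param) : ℝ :=
  1 / (scale₂ D a ^ β * (β + 1) ^ 2) * Real.exp (-(shift D a / scale₂ D a * (β + 1))) *
    (Real.exp (-(D.τ₁ / scale₂ D a * (β + 1))) * (D.τ₁ / scale₂ D a * (β + 1) + 1)
      - Real.exp (-(D.τ₂ / scale₂ D a * (β + 1))) * (D.τ₂ / scale₂ D a * (β + 1) + 1))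

/-- The common factor of the terms of the second stress level that are quadratic in `t`. -/
def M₂ (β : ℝ) (a : Param) : ℝ :=
  1 / (scale₂ D a ^ β * (β + 1) ^ 3) * Real.exp (-(shift D a / scale₂ D a * (β + 1))) *
    (Real.exp (-(D.τ₁ / scale₂ D a * (β + 1))) *
        ((D.τ₁ / scale₂ D a * (β + 1)) ^ 2 + 2 * D.τ₁ / scale₂ D a * (β + 1) + 2)
      - Real.exp (-(D.τ₂ / scale₂ D a * (β + 1))) *
        ((D.τ₂ / scale₂ D a * (β + 1)) ^ 2 + 2 * D.τ₂ / scale₂ D a * (β + 1) + 2))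

/-- `J_{0,τ₁}^β(a₀)`. -/
def JFirst (β : ℝ) (a : Param) : ℝ :=
  1 / (scale₁ D a ^ β * (β + 1)) *
    (Real.exp (-(D.τ₁ / scale₁ D a * (β + 1))) *
        (-1 - 1 / (β + 1) ^ 2 *
            ((D.τ₁ / scale₁ D a * (β + 1)) ^ 2 + 2 * D.τ₁ / scale₁ D a * (β + 1) + 2)
          + 2 / (β + 1) * (D.τ₁ / scale₁ D a * (β + 1) + 1))
      + 1 + 2 / (β + 1) ^ 2 - 2 / (β + 1))

/-- `J_β(a₀)`. -/
def J₀₀ (β : ℝ) (a : Param) : ℝ :=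
  JFirst D β a + (L D a ^ 2 * M₀ D β a + M₂ D β a + 2 * L D a * M₁ D β a)
    + S D a ^ 2 * Real.exp (-(S D a * (β + 1)))

/-- `J_β(a₁)`. -/
def J₁₁ (β : ℝ) (a : Param) : ℝ :=
  D.x₁ ^ 2 * JFirst D β a
    + (Lstar D a ^ 2 * M₀ D β a + D.x₂ ^ 2 * M₂ D β a + 2 * Lstar D a * D.x₂ * M₁ D β a)
    + Sstar D a ^ 2 * Real.exp (-(S D a * (β + 1)))

/-- `J_β(a₀, a₁) = J_β(a₁, a₀)`. -/
def J₀₁ (β : ℝ) (a : Param) : ℝ :=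
  D.x₁ * JFirst D β a
    + (Lstar D a * L D a * M₀ D β a + D.x₂ * M₂ D β a
      + (Lstar D a + D.x₂ * L D a) * M₁ D β a)
    + Sstar D a * S D a * Real.exp (-(S D a * (β + 1)))

/-- The matrix `J_β(a₀, a₁)`. -/
def J (β : ℝ) (a : Param) : Matrix (Fin 2) (Fin 2) ℝ :=
  !![J₀₀ D β a, J₀₁ D β a; J₀₁ D β a, J₁₁ D β a]

/-- `ξ_{0,τ₁}^β(a₀)`. -/
def ξFirst (β : ℝ) (a : Param) : ℝ :=
  -(1 / (scale₁ D a ^ β * (β + 1))) * (1 - Real.exp (-(D.τ₁ / scale₁ D a * (β + 1))))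
    + 1 / (scale₁ D a ^ β * (β + 1) ^ 2) *
      (1 - Real.exp (-(D.τ₁ / scale₁ D a * (β + 1))) * (D.τ₁ / scale₁ D a * (β + 1) + 1))

/-- The vector `ξ_β(a₀, a₁) = (ξ_β(a₀), ξ_β(a₁))`. -/
def ξ (β : ℝ) (a : Param) : Fin 2 → ℝ :=
  ![ξFirst D β a + (L D a * M₀ D β a + M₁ D β a) + S D a * Real.exp (-(S D a * (β + 1))),
    D.x₁ * ξFirst D β a + (Lstar D a * M₀ D β a + D.x₂ * M₁ D β a)
      + Sstar D a * Real.exp (-(S D a * (β + 1)))]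

/-- The matrix `K_β(a₀, a₁) = J_{2β}(a₀, a₁) - ξ_β(a₀, a₁)ᵀ ξ_β(a₀, a₁)`, the last term being the
rank-one matrix with entries `ξ_i ξ_j`. -/
def K (β : ℝ) (a : Param) : Matrix (Fin 2) (Fin 2) ℝ :=
  J D (2 * β) a - Matrix.vecMulVec (ξ D β a) (ξ D β a)

/-- The asymptotic covariance matrix `J_β⁻¹ K_β J_β⁻¹`. -/
def asympCov (β : ℝ) (a : Param) : Matrix (Fin 2) (Fin 2) ℝ :=
  (J D β a)⁻¹ * K D β a * (J D β a)⁻¹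

end SSALT

end

/-!
The loss of a sample is, up to an increasing affine map, the average of a contrast
`m_β(b, z) = ∫ f_b ^ (β + 1) - (β + 1) φ_β(log f_b(z))` over the observations, where `f_b` is the
density of a Type-I censored lifetime (`logDens`) with respect to a reference measure (Lebesgue
measure on the two stages and an atom for the survivors, `refMeasure`), and
`φ_β(x) = (exp (β x) - 1) / β`, continued by `φ_0(x) = x`. This treats maximum likelihood and
`β > 0` together: the estimator is an M-estimator with a smooth contrast, and the observations take
values in a compact set.

*Asymptotic normality* (`tendstoInDistribution_sqrt_smul_sub`). A consistent estimator `θ̂` solves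
`avg ∇m(θ̂) = 0`. Expanding around the true parameter `a`, with a law of large numbers for the
Hessian, shows that `√N (θ̂ - a)` differs from `-N^(-1/2) ∑ V⁻¹ ∇m(a, Zᵢ)` by a relatively small
quantity, where `V` is the mean Hessian. The central limit theorem gives the limit. At the true
parameter the second derivatives of `log f` cancel, so `V = (β + 1) J_β` with
`J_β = ∫ f ^ (β + 1) score scoreᵀ` (`integral_contrastHess`), and the covariance matrix of
`∇m / (β + 1)` is `K_β` (`integral_inner_powerScore_sub_sq`). The closed forms of `J_β` and `ξ_β`
are truncated exponential moments of order at most two (`integral_exp_mul_inner_score_mul`,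
`integral_exp_mul_inner_score`). `J_β` is invertible because a vector orthogonal to all
values of the score is orthogonal to `(1, x₁)` and `(1, x₂)`.

*Consistency* (`ae_separation`). The parameter set is not compact, so it has to be shown that almost
surely, for large `N`, the average contrast away from `a` exceeds its value at `a`. On compact sets
this follows from the uniform law of large numbers and from identifiability, which is a pointwise
Young inequality (`contrast_lt_of_ne`). For `β = 0` the contrast is convex, and it is enough to look
at a sphere around `a`. For `β > 0` the average contrast is a sum of contributions of the two stages
and of the survivors. Each of them is asymptotically bounded below by its population value at `a`,
uniformly in the parameter, and the contribution of a stage is asymptotically nonnegative when its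
scale `exp v` is extreme, while the population value is strictly negative
(`ae_eventually_neg_le_stageLoss`). The delicate case is `v → -∞`, where the density is unbounded.
There `exp (-x) ≤ x ^ (-s)` bounds the empirical mean of the `β`-th power of the density by
`C exp ((s - β) v)`, where `C` is controlled by the integrability of `t ^ (-s)` for `s < 1`. If also
`s > β / (β + 1)`, Young's inequality shows that the penalty `∫ f ^ (β + 1)`, of order
`exp (-β v)`, compensates the empirical term.
-/

open scoped Topology

noncomputable section

/-! ### Averages of independent identically distributed variables -/

namespace MEstimation

section Averages

/-- The average `N⁻¹ • ∑ i < N, f i` of the first `N` terms of a sequence (`0` for `N = 0`). -/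
def avg {W : Type*} [AddCommGroup W] [Module ℝ W] (N : ℕ) (f : ℕ → W) : W :=
  (N : ℝ)⁻¹ • ∑ i ∈ Finset.range N, f i

variable {W : Type*}

lemma avg_add [AddCommGroup W] [Module ℝ W] (N : ℕ) (f g : ℕ → W) :
    avg N (fun i => f i + g i) = avg N f + avg N g := by
  simp [avg, Finset.sum_add_distrib]

lemma avg_sub [AddCommGroup W] [Module ℝ W] (N : ℕ) (f g : ℕ → W) :
    avg N (fun i => f i - g i) = avg N f - avg N g := by
  simp [avg, Finset.sum_sub_distrib, smul_sub]

lemma avg_const [AddCommGroup W] [Module ℝ W] {N : ℕ} (hN : N ≠ 0) (w : W) :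
    avg N (fun _ => w) = w := by
  simp [avg, ← Nat.cast_smul_eq_nsmul ℝ, smul_smul, hN]

lemma avg_mono {N : ℕ} {f g : ℕ → ℝ} (h : ∀ i, f i ≤ g i) : avg N f ≤ avg N g := by
  simp only [avg, smul_eq_mul]
  gcongr with i
  exact h i

lemma avg_mul_left (N : ℕ) (r : ℝ) (f : ℕ → ℝ) : avg N (fun i => r * f i) = r * avg N f := by
  simp only [avg, smul_eq_mul, ← Finset.mul_sum]
  ring

lemma norm_avg_le [NormedAddCommGroup W] [NormedSpace ℝ W] {N : ℕ} {f : ℕ → W} {r : ℝ}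
    (hr : 0 ≤ r) (h : ∀ i, ‖f i‖ ≤ r) : ‖avg N f‖ ≤ r := by
  rcases eq_or_ne N 0 with rfl | hN
  · simpa [avg] using hr
  have hN' : (0 : ℝ) < N := by positivity
  rw [avg, norm_smul, norm_inv, Real.norm_natCast, inv_mul_le_iff₀ hN']
  calc ‖∑ i ∈ Finset.range N, f i‖ ≤ ∑ i ∈ Finset.range N, ‖f i‖ := norm_sum_le _ _
    _ ≤ ∑ i ∈ Finset.range N, r := Finset.sum_le_sum fun i _ => h i
    _ = N * r := by simp

end Averages

/-- A jointly continuous function is equicontinuous in its first variable, uniformly over a compact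
range of the second one. -/
lemma eventually_forall_norm_sub_lt {X 𝒵 W : Type*} [TopologicalSpace X] [TopologicalSpace 𝒵]
    [SeminormedAddCommGroup W] {F : X → 𝒵 → W} (hF : Continuous fun p : X × 𝒵 => F p.1 p.2)
    {K : Set 𝒵} (hK : IsCompact K) (x₀ : X) {ε : ℝ} (hε : 0 < ε) :
    ∀ᶠ x in 𝓝 x₀, ∀ z ∈ K, ‖F x z - F x₀ z‖ < ε := by
  refine hK.eventually_forall_of_forall_eventually fun z _ => ?_
  have hc : Continuous fun p : X × 𝒵 => ‖F p.1 p.2 - F x₀ p.2‖ := by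
    have : Continuous fun p : X × 𝒵 => F x₀ p.2 :=
      hF.comp (continuous_const.prodMk continuous_snd)
    exact (hF.sub this).norm
  exact hc.continuousAt.eventually_lt continuousAt_const (by simpa using hε)

section LLN

variable {Ω 𝒵 : Type*} [MeasurableSpace Ω] {P : Measure Ω} [IsProbabilityMeasure P]
  [TopologicalSpace 𝒵] [MeasurableSpace 𝒵] [BorelSpace 𝒵] {Z : ℕ → Ω → 𝒵} {K : Set 𝒵}

lemma integrable_comp_of_continuous {W : Type*} [NormedAddCommGroup W] [SecondCountableTopology 𝒵]
    {f : 𝒵 → W} (hf : Continuous f) {X : Ω → 𝒵} (hX : AEMeasurable X P) (hK : IsCompact K)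
    (hXK : ∀ᵐ ω ∂P, X ω ∈ K) : Integrable (fun ω => f (X ω)) P := by
  obtain ⟨C, hC⟩ := hK.exists_bound_of_continuousOn hf.continuousOn
  refine Integrable.of_bound (C := C) (hf.aestronglyMeasurable.comp_aemeasurable hX) ?_
  filter_upwards [hXK] with ω hω using hC _ hω

/-- The strong law of large numbers for continuous functions of independent observations with values
in a compact set. -/
lemma ae_tendsto_avg {W : Type*} [NormedAddCommGroup W] [NormedSpace ℝ W] [CompleteSpace W]
    [SecondCountableTopology 𝒵]
    (hindep : iIndepFun Z P) (hident : ∀ i, IdentDistrib (Z i) (Z 0) P P)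
    (hK : IsCompact K) (hZK : ∀ᵐ ω ∂P, ∀ i, Z i ω ∈ K) {f : 𝒵 → W} (hf : Continuous f) :
    ∀ᵐ ω ∂P, Tendsto (fun N => avg N fun i => f (Z i ω)) atTop (𝓝 (∫ ω, f (Z 0 ω) ∂P)) := by
  borelize W
  refine strong_law_ae (fun i ω => f (Z i ω)) ?_ ?_ ?_
  · exact integrable_comp_of_continuous hf (hident 0).aemeasurable_fst hK
      (hZK.mono fun ω h => h 0)
  · intro i j hij
    exact (hindep.comp (fun _ => f) fun _ => hf.measurable).indepFun hij
  · exact fun i => (hident i).comp hf.measurable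

/-- The uniform law of large numbers over a compact set of parameters. -/
lemma ae_eventually_forall_abs_avg_sub_lt {X : Type*} [TopologicalSpace X]
    [SecondCountableTopology 𝒵]
    (hindep : iIndepFun Z P) (hident : ∀ i, IdentDistrib (Z i) (Z 0) P P)
    (hK : IsCompact K) (hZK : ∀ᵐ ω ∂P, ∀ i, Z i ω ∈ K) {F : X → 𝒵 → ℝ}
    (hF : Continuous fun p : X × 𝒵 => F p.1 p.2) {C : Set X} (hC : IsCompact C) {ε : ℝ}
    (hε : 0 < ε) :
    ∀ᵐ ω ∂P, ∀ᶠ N in atTop, ∀ x ∈ C, |(avg N fun i => F x (Z i ω)) - ∫ ω, F x (Z 0 ω) ∂P| < ε := by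
  have hFx : ∀ x, Continuous (F x) := fun x => hF.comp (continuous_const.prodMk continuous_id)
  have hnhds : ∀ x ∈ C, {y | ∀ z ∈ K, ‖F y z - F x z‖ < ε / 4} ∈ 𝓝 x := fun x _ =>
    eventually_forall_norm_sub_lt hF hK x (by positivity)
  obtain ⟨s, hsC, hs⟩ := hC.elim_nhds_subcover _ hnhds
  have hlln : ∀ᵐ ω ∂P, ∀ x ∈ s,
      Tendsto (fun N => avg N fun i => F x (Z i ω)) atTop (𝓝 (∫ ω, F x (Z 0 ω) ∂P)) := by
    refine (ae_ball_iff s.countable_toSet).2 fun x _ => ?_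
    exact ae_tendsto_avg hindep hident hK hZK (hFx x)
  filter_upwards [hlln, hZK] with ω hω hωK
  have hev : ∀ᶠ N in atTop, ∀ x ∈ s,
      |(avg N fun i => F x (Z i ω)) - ∫ ω, F x (Z 0 ω) ∂P| < ε / 4 := by
    rw [eventually_all_finset]
    intro x hx
    have := (hω x hx).eventually (Metric.ball_mem_nhds _ (show 0 < ε / 4 by positivity))
    simpa [Real.dist_eq] using! this
  filter_upwards [hev] with N hN y hy
  obtain ⟨x, hxs, hxy⟩ : ∃ x ∈ s, ∀ z ∈ K, ‖F y z - F x z‖ < ε / 4 := by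
    simpa using hs hy
  have h1 : |(avg N fun i => F y (Z i ω)) - avg N fun i => F x (Z i ω)| ≤ ε / 4 := by
    rw [← avg_sub]
    exact norm_avg_le (by positivity) fun i => (hxy _ (hωK i)).le
  have h2 : |(∫ ω, F y (Z 0 ω) ∂P) - ∫ ω, F x (Z 0 ω) ∂P| ≤ ε / 4 := by
    have hi : ∀ x, Integrable (fun ω => F x (Z 0 ω)) P := fun x =>
      integrable_comp_of_continuous (hFx x) (hident 0).aemeasurable_fst hK (hZK.mono fun ω h => h 0)
    rw [← integral_sub (hi y) (hi x)]
    have hle : ∀ᵐ ω' ∂P, ‖F y (Z 0 ω') - F x (Z 0 ω')‖ ≤ ε / 4 := by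
      filter_upwards [hZK] with ω' hω' using (hxy _ (hω' 0)).le
    simpa using norm_integral_le_of_norm_le_const hle
  have h3 := hN x hxs
  rw [abs_le] at h1 h2
  rw [abs_lt] at h3 ⊢
  constructor <;> linarith [h1.1, h1.2, h2.1, h2.2, h3.1, h3.2]

end LLN

/-! ### The multivariate central limit theorem -/

section CLT

variable {Ω : Type*} [MeasurableSpace Ω] {P : Measure Ω} [IsProbabilityMeasure P]

open Matrix in
/-- The multivariate central limit theorem, deduced from the one-dimensional one by the
Cramér–Wold device. -/
theorem tendstoInDistribution_multivariateGaussian {ι : Type*} [Fintype ι] [DecidableEq ι]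
    {Y : ℕ → Ω → EuclideanSpace ℝ ι} (hindep : iIndepFun Y P)
    (hident : ∀ i, IdentDistrib (Y i) (Y 0) P P) (hL2 : MemLp (Y 0) 2 P)
    (h0 : ∀ t, ∫ ω, inner ℝ (Y 0 ω) t ∂P = 0) {A : Matrix ι ι ℝ} (hA : A.PosSemidef)
    (hcov : ∀ t : EuclideanSpace ℝ ι, ∫ ω, (inner ℝ (Y 0 ω) t) ^ 2 ∂P = t ⬝ᵥ A *ᵥ t) :
    TendstoInDistribution (fun (N : ℕ) ω => (√N)⁻¹ • ∑ i ∈ Finset.range N, Y i ω) atTop id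
      (fun _ => P) (multivariateGaussian 0 A) where
  forall_aemeasurable N := by
    have := fun i => (hident i).aemeasurable_fst
    fun_prop
  aemeasurable_limit := aemeasurable_id
  tendsto := by
    have hmeas : ∀ N : ℕ, AEMeasurable (fun ω => (√N)⁻¹ • ∑ i ∈ Finset.range N, Y i ω) P :=
      fun N => by
        have := fun i => (hident i).aemeasurable_fst
        fun_prop
    refine ProbabilityMeasure.tendsto_iff_tendsto_charFun.2 fun t => ?_
    have hm : Measurable fun y : EuclideanSpace ℝ ι => inner ℝ y t := by fun_prop
    set X : ℕ → Ω → ℝ := fun i ω => inner ℝ (Y i ω) t with hX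
    have hXL2 : MemLp (X 0) 2 P := hL2.inner_const t
    have hvar : Var[X 0; P] = t ⬝ᵥ A *ᵥ t := by
      rw [variance_eq_integral hXL2.aestronglyMeasurable.aemeasurable, h0 t, ← hcov t]
      simp [hX]
    have hclt := tendstoInDistribution_inv_sqrt_mul_sum_sub
      (Y := id) (P' := gaussianReal 0 Var[X 0; P].toNNReal) HasLaw.id hXL2
      (hindep.comp (fun _ y => inner ℝ y t) fun _ => hm) fun i => (hident i).comp hm
    have hch := ProbabilityMeasure.tendsto_iff_tendsto_charFun.1 hclt.tendsto 1
    refine (hch.congr fun N => ?_).trans_eq ?_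
    · simp only [ProbabilityMeasure.coe_mk, charFun_apply]
      rw [integral_map (hclt.forall_aemeasurable N) (by fun_prop),
        integral_map (hmeas N) (by fun_prop)]
      congr 1 with ω
      simp only [hX, h0 t, inner_smul_left, sum_inner]
      simp
    · simp only [ProbabilityMeasure.coe_mk, Measure.map_id]
      rw [charFun_gaussianReal, charFun_multivariateGaussian hA]
      have := variance_nonneg (X 0) P
      rw [hvar] at this
      simp [hvar, max_eq_left this]

end CLT

end MEstimation

/-! ### Asymptotic normality of M-estimators -/

namespace MEstimation

variable {Ω 𝒵 E : Type*} [MeasurableSpace Ω] {P : Measure Ω} [IsProbabilityMeasure P]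
  [TopologicalSpace 𝒵] [MeasurableSpace 𝒵] [BorelSpace 𝒵] [SecondCountableTopology 𝒵]
  {Z : ℕ → Ω → 𝒵} {K : Set 𝒵}
  [NormedAddCommGroup E] [InnerProductSpace ℝ E] [FiniteDimensional ℝ E]

/-- First-order expansion of the average score around `θ₀`, with a remainder that is
small compared to `θ - θ₀`, uniformly in `θ` near `θ₀`. -/
lemma ae_eventually_norm_avg_sub_le
    (hindep : iIndepFun Z P) (hident : ∀ i, IdentDistrib (Z i) (Z 0) P P)
    (hK : IsCompact K) (hZK : ∀ᵐ ω ∂P, ∀ i, Z i ω ∈ K)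
    {Ψ : E → 𝒵 → E} {H : E → 𝒵 → E →L[ℝ] E} (θ₀ : E)
    (hΨ : ∀ θ z, HasFDerivAt (fun θ => Ψ θ z) (H θ z) θ)
    (hH : Continuous fun p : E × 𝒵 => H p.1 p.2)
    {est : ℕ → Ω → E} (hcons : ∀ᵐ ω ∂P, Tendsto (fun N => est N ω) atTop (𝓝 θ₀)) :
    ∀ᵐ ω ∂P, ∀ ε > 0, ∀ᶠ N in atTop,
      ‖(avg N fun i => Ψ (est N ω) (Z i ω)) - (avg N fun i => Ψ θ₀ (Z i ω)) -
        (∫ ω, H θ₀ (Z 0 ω) ∂P) (est N ω - θ₀)‖ ≤ ε * ‖est N ω - θ₀‖ := by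
  have hH0 : Continuous (H θ₀) := hH.comp (continuous_const.prodMk continuous_id)
  filter_upwards [ae_tendsto_avg hindep hident hK hZK hH0, hcons, hZK] with ω hlln hω hωK ε hε
  have hnear := eventually_forall_norm_sub_lt hH hK θ₀ (half_pos hε)
  obtain ⟨r, hr, hball⟩ := Metric.eventually_nhds_iff_ball.1 hnear
  filter_upwards [hω.eventually (Metric.ball_mem_nhds θ₀ hr),
    hlln.eventually (Metric.ball_mem_nhds _ (half_pos hε))] with N hN hNH
  have h1 : ∀ i, ‖Ψ (est N ω) (Z i ω) - Ψ θ₀ (Z i ω) - H θ₀ (Z i ω) (est N ω - θ₀)‖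
      ≤ ε / 2 * ‖est N ω - θ₀‖ := fun i =>
    Convex.norm_image_sub_le_of_norm_hasFDerivWithin_le' (f := fun θ => Ψ θ (Z i ω))
      (f' := fun θ => H θ (Z i ω)) (s := Metric.ball θ₀ r)
      (fun θ _ => (hΨ θ _).hasFDerivWithinAt)
      (fun θ hθ => (hball θ hθ _ (hωK i)).le) (convex_ball _ _) (Metric.mem_ball_self hr) hN
  have h2 := norm_avg_le (N := N) (by positivity) h1
  have hrw : (avg N fun i => Ψ (est N ω) (Z i ω) - Ψ θ₀ (Z i ω) - H θ₀ (Z i ω) (est N ω - θ₀)) =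
      (avg N fun i => Ψ (est N ω) (Z i ω)) - (avg N fun i => Ψ θ₀ (Z i ω)) -
        (avg N fun i => H θ₀ (Z i ω)) (est N ω - θ₀) := by
    rw [avg_sub, avg_sub]
    congr 1
    simp [avg]
  rw [hrw] at h2
  have h3 : ‖((avg N fun i => H θ₀ (Z i ω)) - ∫ ω, H θ₀ (Z 0 ω) ∂P) (est N ω - θ₀)‖ ≤
      ε / 2 * ‖est N ω - θ₀‖ := by
    refine (ContinuousLinearMap.le_opNorm _ _).trans ?_
    gcongr
    exact (mem_ball_iff_norm.1 hNH).le
  calc _ = ‖((avg N fun i => Ψ (est N ω) (Z i ω)) - (avg N fun i => Ψ θ₀ (Z i ω)) -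
        (avg N fun i => H θ₀ (Z i ω)) (est N ω - θ₀)) +
        ((avg N fun i => H θ₀ (Z i ω)) - ∫ ω, H θ₀ (Z 0 ω) ∂P) (est N ω - θ₀)‖ := by
        congr 1
        simp only [sub_apply]
        abel
    _ ≤ ε / 2 * ‖est N ω - θ₀‖ + ε / 2 * ‖est N ω - θ₀‖ :=
        (norm_add_le _ _).trans (add_le_add h2 h3)
    _ = ε * ‖est N ω - θ₀‖ := by ring

variable [MeasurableSpace E] [BorelSpace E]

/-- If `‖Y N - X N‖ = o(‖X N‖)` almost surely, then `Y` inherits the limit in distribution of `X`.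
The difference is a random linear map applied to `X N`, of rank one and with norm tending to `0`,
which makes Slutsky's theorem applicable. -/
lemma tendstoInDistribution_of_norm_sub_le {Ω' : Type*} [MeasurableSpace Ω'] {Q : Measure Ω'}
    [IsProbabilityMeasure Q] {X Y : ℕ → Ω → E} {G : Ω' → E}
    (hX : TendstoInDistribution X atTop G (fun _ => P) Q) (hY : ∀ N, AEMeasurable (Y N) P)
    (hXY : ∀ᵐ ω ∂P, ∀ ε > 0, ∀ᶠ N in atTop, ‖Y N ω - X N ω‖ ≤ ε * ‖X N ω‖) :
    TendstoInDistribution Y atTop G (fun _ => P) Q := by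
  have hXm := hX.forall_aemeasurable
  set A : ℕ → Ω → E →L[ℝ] E := fun N ω =>
    (‖X N ω‖ ^ 2)⁻¹ • (innerSL ℝ (X N ω)).smulRight (Y N ω - X N ω) with hA
  have hAm : ∀ N, AEMeasurable (A N) P := fun N => by
    refine AEMeasurable.smul ((hXm N).norm.pow_const 2).inv ?_
    have hc : Continuous fun p : E × E => (innerSL ℝ p.1).smulRight p.2 := by
      have : Continuous fun p : E × E =>
          ContinuousLinearMap.smulRightL ℝ E E (innerSL ℝ p.1) p.2 := by fun_prop
      exact this
    exact hc.measurable.comp_aemeasurable ((hXm N).prodMk ((hY N).sub (hXm N)))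
  have hA0 : TendstoInMeasure P A atTop fun _ => 0 := by
    refine tendstoInMeasure_of_tendsto_ae (fun N => (hAm N).aestronglyMeasurable) ?_
    filter_upwards [hXY] with ω hω
    rw [tendsto_zero_iff_norm_tendsto_zero, Metric.tendsto_atTop']
    intro ε hε
    obtain ⟨N₀, hN₀⟩ := eventually_atTop.1 (hω (ε / 2) (half_pos hε))
    refine ⟨N₀, fun N hN => ?_⟩
    have h := hN₀ N hN.le
    rw [Real.dist_eq, sub_zero, abs_norm]
    refine lt_of_le_of_lt ?_ (half_lt_self hε)
    rw [hA, norm_smul, ContinuousLinearMap.norm_smulRight_apply, innerSL_apply_norm, norm_inv,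
      norm_pow, norm_norm]
    rcases eq_or_ne (‖X N ω‖) 0 with h0 | h0
    · simpa [h0] using (half_pos hε).le
    · have : 0 < ‖X N ω‖ := lt_of_le_of_ne (norm_nonneg _) h0.symm
      rw [inv_mul_le_iff₀ (by positivity)]
      nlinarith
  have hS := hX.continuous_comp_prodMk_of_tendstoInMeasure_const
    (g := fun p : E × (E →L[ℝ] E) => p.1 + p.2 p.1) (by fun_prop) hA0 hAm
  refine tendstoInDistribution_of_tendstoInMeasure_sub Y G
    (X := fun N ω => X N ω + A N ω (X N ω)) (by simpa using hS) ?_ hY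
  refine tendstoInMeasure_of_tendsto_ae
    (fun N => ((hY N).sub (hS.forall_aemeasurable N)).aestronglyMeasurable) ?_
  filter_upwards [hXY] with ω hω
  refine tendsto_const_nhds.congr' ?_
  filter_upwards [hω 1 one_pos] with N hN
  rcases eq_or_ne (X N ω) 0 with h0 | h0
  · have : Y N ω = 0 := by simpa [h0] using hN
    simp [hA, h0, this]
  · have : ‖X N ω‖ ^ 2 ≠ 0 := by simpa using h0
    simp [hA, smul_smul, inv_mul_cancel₀ this]

/-- Asymptotic normality of consistent zeros of the average score: if `V` is the mean of the
derivative of the score at `θ₀` and `W V = 1`, then `√N (θ̂ - θ₀)` has the same limit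
in distribution as the normalised sum of the influence functions `-W Ψ(θ₀, Zᵢ)`. -/
theorem tendstoInDistribution_sqrt_smul_sub
    (hindep : iIndepFun Z P) (hident : ∀ i, IdentDistrib (Z i) (Z 0) P P)
    (hK : IsCompact K) (hZK : ∀ᵐ ω ∂P, ∀ i, Z i ω ∈ K)
    {Ψ : E → 𝒵 → E} {H : E → 𝒵 → E →L[ℝ] E} (θ₀ : E)
    (hΨ : ∀ θ z, HasFDerivAt (fun θ => Ψ θ z) (H θ z) θ)
    (hH : Continuous fun p : E × 𝒵 => H p.1 p.2)
    {W : E →L[ℝ] E} (hW : W ∘L (∫ ω, H θ₀ (Z 0 ω) ∂P) = ContinuousLinearMap.id ℝ E)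
    {est : ℕ → Ω → E} (hest : ∀ N, AEMeasurable (est N) P)
    (hcons : ∀ᵐ ω ∂P, Tendsto (fun N => est N ω) atTop (𝓝 θ₀))
    (hzero : ∀ᵐ ω ∂P, ∀ᶠ N in atTop, (avg N fun i => Ψ (est N ω) (Z i ω)) = 0)
    {Ω' : Type*} [MeasurableSpace Ω'] {Q : Measure Ω'} [IsProbabilityMeasure Q] {G : Ω' → E}
    (hclt : TendstoInDistribution
      (fun (N : ℕ) ω => (√N)⁻¹ • ∑ i ∈ Finset.range N, -W (Ψ θ₀ (Z i ω))) atTop G (fun _ => P) Q) :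
    TendstoInDistribution (fun (N : ℕ) ω => √N • (est N ω - θ₀)) atTop G (fun _ => P) Q := by
  refine tendstoInDistribution_of_norm_sub_le hclt
    (fun N => ((hest N).sub_const θ₀).const_smul (√N)) ?_
  filter_upwards [ae_eventually_norm_avg_sub_le hindep hident hK hZK θ₀ hΨ hH hcons, hzero]
    with ω hexp hω ε hε
  set κ : ℝ := min ε 1 / (2 * (‖W‖ + 1)) with hκ
  have hκ0 : 0 < κ := by positivity
  filter_upwards [hexp κ hκ0, hω, eventually_gt_atTop 0] with N hN hN0 hNpos
  set δ := est N ω - θ₀ with hδ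
  set g : E := avg N fun i => -W (Ψ θ₀ (Z i ω)) with hg
  have hgW : g = -W (avg N fun i => Ψ θ₀ (Z i ω)) := by simp [hg, avg]
  have h1 : ‖δ - g‖ ≤ min ε 1 / 2 * ‖δ‖ := by
    have hWV : W ((∫ ω, H θ₀ (Z 0 ω) ∂P) δ) = δ := by
      simpa using congrArg (fun A : E →L[ℝ] E => A δ) hW
    have hrw : δ - g = -W ((avg N fun i => Ψ (est N ω) (Z i ω)) - (avg N fun i => Ψ θ₀ (Z i ω)) -
        (∫ ω, H θ₀ (Z 0 ω) ∂P) δ) := by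
      rw [hN0, hgW, map_sub, map_sub, hWV, map_zero]
      abel
    rw [hrw, norm_neg]
    refine (W.le_opNorm _).trans ?_
    calc ‖W‖ * _ ≤ (‖W‖ + 1) * (κ * ‖δ‖) := by gcongr; linarith
      _ = min ε 1 / 2 * ‖δ‖ := by rw [hκ]; field_simp
  have h2 : ‖δ - g‖ ≤ ε * ‖g‖ := by
    have h3 : ‖δ‖ ≤ ‖δ - g‖ + ‖g‖ := by simpa using norm_add_le (δ - g) g
    have h4 : min ε 1 ≤ 1 := min_le_right _ _
    have h5 : min ε 1 ≤ ε := min_le_left _ _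
    have h6 : ‖δ‖ ≤ 2 * ‖g‖ := by nlinarith [norm_nonneg δ]
    calc ‖δ - g‖ ≤ min ε 1 / 2 * ‖δ‖ := h1
      _ ≤ ε / 2 * (2 * ‖g‖) := by gcongr
      _ = ε * ‖g‖ := by ring
  have hsum : (√N)⁻¹ • ∑ i ∈ Finset.range N, -W (Ψ θ₀ (Z i ω)) = √N • g := by
    have hs : √(N : ℝ) ≠ 0 := by positivity
    rw [hg, avg, smul_smul]
    congr 1
    have hN' : (N : ℝ) ≠ 0 := by positivity
    rw [eq_mul_inv_iff_mul_eq₀ hN', inv_mul_eq_iff_eq_mul₀ hs, Real.mul_self_sqrt N.cast_nonneg]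
  rw [hsum, ← smul_sub, norm_smul, norm_smul]
  calc _ ≤ ‖√(N : ℝ)‖ * (ε * ‖g‖) := by gcongr
    _ = _ := by ring

end MEstimation

/-! ### Integrals depending on a parameter -/

namespace MEstimation

section ParametricIntegral

variable {E 𝒵 G : Type*} [NormedAddCommGroup E] [NormedSpace ℝ E]
  [TopologicalSpace 𝒵] [MeasurableSpace 𝒵] [BorelSpace 𝒵] [SecondCountableTopology 𝒵]
  [NormedAddCommGroup G] {μ : Measure 𝒵} [IsFiniteMeasure μ] {K : Set 𝒵}

lemma _root_.Continuous.integrable_of_ae_mem_isCompact {f : 𝒵 → G} (hf : Continuous f)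
    (hK : IsCompact K) (hμ : ∀ᵐ z ∂μ, z ∈ K) : Integrable f μ := by
  obtain ⟨C, hC⟩ := hK.exists_bound_of_continuousOn hf.continuousOn
  exact Integrable.of_bound (C := C) hf.aestronglyMeasurable (hμ.mono fun z hz => hC z hz)

variable [NormedSpace ℝ G]

lemma continuous_integral_of_isCompact {X : Type*} [TopologicalSpace X] {F : X → 𝒵 → G}
    (hF : Continuous fun p : X × 𝒵 => F p.1 p.2) (hK : IsCompact K) (hμ : ∀ᵐ z ∂μ, z ∈ K) :
    Continuous fun x => ∫ z, F x z ∂μ := by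
  have hFx : ∀ x, Integrable (F x) μ := fun x =>
    (hF.comp (continuous_const.prodMk continuous_id)).integrable_of_ae_mem_isCompact hK hμ
  refine continuous_iff_continuousAt.2 fun x₀ => Metric.tendsto_nhds.2 fun ε hε => ?_
  set C : ℝ := μ.real Set.univ + 1 with hC
  have hC0 : 0 < C := by positivity
  filter_upwards [eventually_forall_norm_sub_lt hF hK x₀ (div_pos hε hC0)] with x hx
  rw [dist_eq_norm, ← integral_sub (hFx x) (hFx x₀)]
  calc _ ≤ ε / C * μ.real Set.univ :=
        norm_integral_le_of_norm_le_const (hμ.mono fun z hz => (hx z hz).le)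
    _ < ε / C * C := by gcongr; simp [hC]
    _ = ε := by field_simp

/-- Differentiation under the integral sign, for a finite measure carried by a compact set. -/
lemma hasFDerivAt_integral_of_isCompact {F : E → 𝒵 → G} {F' : E → 𝒵 → E →L[ℝ] G}
    (hF : ∀ x z, HasFDerivAt (fun x => F x z) (F' x z) x) (hFc : ∀ x, Continuous (F x))
    (hF' : Continuous fun p : E × 𝒵 => F' p.1 p.2) (hK : IsCompact K) (hμ : ∀ᵐ z ∂μ, z ∈ K)
    (x₀ : E) : HasFDerivAt (fun x => ∫ z, F x z ∂μ) (∫ z, F' x₀ z ∂μ) x₀ := by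
  have hF'x : Continuous (F' x₀) := hF'.comp (continuous_const.prodMk continuous_id)
  refine hasFDerivAt_integral_of_dominated_of_fderiv_le
    (bound := fun z => ‖F' x₀ z‖ + 1) (s := {x | ∀ z ∈ K, ‖F' x z - F' x₀ z‖ < 1})
    (eventually_forall_norm_sub_lt hF' hK x₀ one_pos)
    (Eventually.of_forall fun x => (hFc x).aestronglyMeasurable)
    ((hFc x₀).integrable_of_ae_mem_isCompact hK hμ) hF'x.aestronglyMeasurable ?_
    ((hF'x.integrable_of_ae_mem_isCompact hK hμ).norm.add (integrable_const 1))
    (Eventually.of_forall fun z x _ => hF x z)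
  filter_upwards [hμ] with z hz x hx
  have h := norm_add_le (F' x z - F' x₀ z) (F' x₀ z)
  rw [sub_add_cancel] at h
  linarith [hx z hz]

end ParametricIntegral

end MEstimation

/-! ### The law of a censored lifetime -/

namespace SSALT

variable (D : Design)

/-- The direction `(1, x₁)` of the parameter plane. -/
def dir₁ : Param := !₂[1, D.x₁]

/-- The direction `(1, x₂)` of the parameter plane. -/
def dir₂ : Param := !₂[1, D.x₂]

/-- `log λ₁`, as a linear functional of the parameter. -/
def logScale₁ : Param →L[ℝ] ℝ := innerSL ℝ (dir₁ D)

/-- `log λ₂`, as a linear functional of the parameter. -/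
def logScale₂ : Param →L[ℝ] ℝ := innerSL ℝ (dir₂ D)

lemma logScale₁_apply (a : Param) : logScale₁ D a = a 0 + a 1 * D.x₁ := by
  simp [logScale₁, dir₁, PiLp.inner_apply]

lemma logScale₂_apply (a : Param) : logScale₂ D a = a 0 + a 1 * D.x₂ := by
  simp [logScale₂, dir₂, PiLp.inner_apply]

lemma scale₁_eq (a : Param) : scale₁ D a = Real.exp (logScale₁ D a) := by
  rw [scale₁, logScale₁_apply]

lemma scale₂_eq (a : Param) : scale₂ D a = Real.exp (logScale₂ D a) := by
  rw [scale₂, logScale₂_apply]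

/-- A Type-I censored lifetime is recorded as `(A, B, p, q)`, where `A` and `B` indicate a failure
under the first and under the second stress, and `p` and `q` are the times spent under the two
stresses. -/
abbrev Obs : Type := ℝ × ℝ × ℝ × ℝ

/-- The record of the unit with lifetime `t`. -/
def obs (t : ℝ) : Obs :=
  if t < D.τ₁ then (1, 0, t, 0)
  else if t < D.τ₂ then (0, 1, D.τ₁, t - D.τ₁) else (0, 0, D.τ₁, D.τ₂ - D.τ₁)

lemma measurable_obs : Measurable (obs D) := by
  unfold obs
  refine Measurable.ite measurableSet_Iio (by fun_prop) (Measurable.ite measurableSet_Iio ?_ ?_) <;>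
    fun_prop

/-- A compact set that contains the records of all nonnegative lifetimes. -/
def obsRange : Set Obs :=
  Set.Icc 0 1 ×ˢ Set.Icc 0 1 ×ˢ Set.Icc 0 D.τ₁ ×ˢ Set.Icc 0 (D.τ₂ - D.τ₁)

lemma isCompact_obsRange : IsCompact (obsRange D) :=
  isCompact_Icc.prod (isCompact_Icc.prod (isCompact_Icc.prod isCompact_Icc))

lemma obs_mem_obsRange (hτ₁ : 0 < D.τ₁) (hτ₂ : D.τ₁ < D.τ₂) {t : ℝ} (ht : 0 ≤ t) :
    obs D t ∈ obsRange D := by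
  unfold obs obsRange
  split_ifs with h1 h2 <;> simp <;> grind

/-- Logarithm of the likelihood contribution of a censored lifetime: the log-density if the failure
is observed, the log-survival probability otherwise. -/
def logDens (a : Param) (z : Obs) : ℝ :=
  -(z.1 * logScale₁ D a + z.2.1 * logScale₂ D a + z.2.2.1 * Real.exp (-logScale₁ D a)
    + z.2.2.2 * Real.exp (-logScale₂ D a))

lemma continuous_logDens : Continuous fun p : Param × Obs => logDens D p.1 p.2 := by
  unfold logDens
  fun_prop

lemma continuous_logDens_right (a : Param) : Continuous (logDens D a) := by
  unfold logDens
  fun_prop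

lemma f₁_eq (a : Param) (t : ℝ) : f₁ D a t = Real.exp (logDens D a (1, 0, t, 0)) := by
  rw [f₁, logDens, scale₁_eq, one_div, ← Real.exp_neg, ← Real.exp_add]
  congr 1
  simp only [Real.exp_neg]
  ring

lemma cumHazard_eq (a : Param) (t : ℝ) : (t + shift D a) / scale₂ D a =
    D.τ₁ * Real.exp (-logScale₁ D a) + (t - D.τ₁) * Real.exp (-logScale₂ D a) := by
  rw [shift, scale₂_eq, scale₁_eq, Real.exp_neg, Real.exp_neg]
  field_simp
  ring

lemma f₂_eq (a : Param) (t : ℝ) :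
    f₂ D a t = Real.exp (logDens D a (0, 1, D.τ₁, t - D.τ₁)) := by
  rw [f₂, logDens, cumHazard_eq, scale₂_eq, one_div, ← Real.exp_neg, ← Real.exp_add]
  congr 1
  ring

lemma one_sub_F₂_eq (a : Param) :
    1 - F₂ D a D.τ₂ = Real.exp (logDens D a (0, 0, D.τ₁, D.τ₂ - D.τ₁)) := by
  rw [F₂, logDens, cumHazard_eq, sub_sub_cancel]
  congr 1
  ring

/-- The measure with respect to which `exp (logDens a ·)` is the density of a censored lifetime:
Lebesgue measure on the observed failures and a unit atom at the censored record. -/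
def refMeasure : Measure Obs :=
  (volume.restrict (Set.Ioc 0 D.τ₁)).map (fun t => (1, 0, t, 0))
    + (volume.restrict (Set.Ioc 0 (D.τ₂ - D.τ₁))).map (fun s => (0, 1, D.τ₁, s))
    + Measure.dirac (0, 0, D.τ₁, D.τ₂ - D.τ₁)

instance : IsFiniteMeasure (refMeasure D) := by
  unfold refMeasure
  infer_instance

lemma ae_refMeasure_mem (hτ₁ : 0 < D.τ₁) (hτ₂ : D.τ₁ < D.τ₂) :
    ∀ᵐ z ∂(refMeasure D), z ∈ obsRange D := by
  have hm : MeasurableSet {z | z ∈ obsRange D} := (isCompact_obsRange D).measurableSet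
  rw [refMeasure, ae_add_measure_iff, ae_add_measure_iff, ae_map_iff (by fun_prop) hm,
    ae_map_iff (by fun_prop) hm, ae_dirac_iff hm]
  refine ⟨⟨?_, ?_⟩, ?_⟩
  · filter_upwards [ae_restrict_mem measurableSet_Ioc] with t ht
    simp [obsRange]
    grind
  · filter_upwards [ae_restrict_mem measurableSet_Ioc] with t ht
    simp [obsRange]
    grind
  · simp [obsRange]
    grind

lemma integral_refMeasure {W : Type*} [NormedAddCommGroup W] [NormedSpace ℝ W] [CompleteSpace W]
    (hτ₁ : 0 < D.τ₁) (hτ₂ : D.τ₁ < D.τ₂) {f : Obs → W} (hf : Continuous f) :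
    ∫ z, f z ∂(refMeasure D) = (∫ t in (0 : ℝ)..D.τ₁, f (1, 0, t, 0))
      + (∫ s in (0 : ℝ)..(D.τ₂ - D.τ₁), f (0, 1, D.τ₁, s)) + f (0, 0, D.τ₁, D.τ₂ - D.τ₁) := by
  have hi : Integrable f (refMeasure D) :=
    hf.integrable_of_ae_mem_isCompact (isCompact_obsRange D) (ae_refMeasure_mem D hτ₁ hτ₂)
  have hi' := hi
  rw [refMeasure, integrable_add_measure, integrable_add_measure] at hi'
  rw [refMeasure, integral_add_measure (hi'.1.1.add_measure hi'.1.2) hi'.2,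
    integral_add_measure hi'.1.1 hi'.1.2, integral_map (by fun_prop) hf.aestronglyMeasurable,
    integral_map (by fun_prop) hf.aestronglyMeasurable, integral_dirac,
    intervalIntegral.integral_of_le hτ₁.le, intervalIntegral.integral_of_le (sub_pos.2 hτ₂).le]

/-- It suffices that the integrand does not vanish at the beginning of one of the two stages. -/
lemma integral_refMeasure_pos (hτ₁ : 0 < D.τ₁) (hτ₂ : D.τ₁ < D.τ₂) {f : Obs → ℝ}
    (hf : Continuous f) (hf0 : ∀ z, 0 ≤ f z)
    (hpos : f (1, 0, 0, 0) ≠ 0 ∨ f (0, 1, D.τ₁, 0) ≠ 0) : 0 < ∫ z, f z ∂(refMeasure D) := by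
  rw [integral_refMeasure D hτ₁ hτ₂ hf]
  have h1 : 0 ≤ ∫ t in (0 : ℝ)..D.τ₁, f (1, 0, t, 0) :=
    intervalIntegral.integral_nonneg hτ₁.le fun t _ => hf0 _
  have h2 : 0 ≤ ∫ t in (0 : ℝ)..(D.τ₂ - D.τ₁), f (0, 1, D.τ₁, t) :=
    intervalIntegral.integral_nonneg (sub_pos.2 hτ₂).le fun t _ => hf0 _
  have h3 := hf0 (0, 0, D.τ₁, D.τ₂ - D.τ₁)
  rcases hpos with h | h
  · have hpos : 0 < ∫ t in (0 : ℝ)..D.τ₁, f (1, 0, t, 0) :=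
      intervalIntegral.integral_pos hτ₁ (by fun_prop) (fun t _ => hf0 _)
        ⟨0, ⟨le_rfl, hτ₁.le⟩, lt_of_le_of_ne (hf0 _) h.symm⟩
    linarith
  · have hpos : 0 < ∫ t in (0 : ℝ)..(D.τ₂ - D.τ₁), f (0, 1, D.τ₁, t) :=
      intervalIntegral.integral_pos (sub_pos.2 hτ₂) (by fun_prop) (fun t _ => hf0 _)
        ⟨0, ⟨le_rfl, (sub_pos.2 hτ₂).le⟩, lt_of_le_of_ne (hf0 _) h.symm⟩
    linarith

lemma measurable_lifetimePDF (a : Param) : Measurable (lifetimePDF D a) := by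
  unfold lifetimePDF
  refine Measurable.ite measurableSet_Iio measurable_const
    (Measurable.ite measurableSet_Iio ?_ ?_)
  · unfold f₁
    fun_prop
  · unfold f₂
    fun_prop

lemma lintegral_f₂_Ici (a : Param) :
    ∫⁻ t in Set.Ici D.τ₂, ENNReal.ofReal (f₂ D a t) =
      ENNReal.ofReal (Real.exp (logDens D a (0, 0, D.τ₁, D.τ₂ - D.τ₁))) := by
  have hpos : 0 < scale₂ D a := by
    rw [scale₂_eq]
    positivity
  set G : ℝ → ℝ := fun t => -Real.exp (-((t + shift D a) / scale₂ D a)) with hG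
  have hderiv : ∀ t, HasDerivAt G (f₂ D a t) t := fun t => by
    have h :=
      (((((hasDerivAt_id t).add_const (shift D a)).div_const (scale₂ D a)).fun_neg).exp).fun_neg
    refine h.congr_deriv ?_
    simp [f₂]
    ring
  have hnonneg : ∀ t, 0 ≤ f₂ D a t := fun t => by
    rw [f₂_eq]
    positivity
  have hlim : Tendsto G atTop (𝓝 0) := by
    have h1 : Tendsto (fun t => (t + shift D a) / scale₂ D a) atTop atTop :=
      (tendsto_atTop_add_const_right _ _ tendsto_id).atTop_div_const hpos
    have h2 := (Real.tendsto_exp_atBot.comp (tendsto_neg_atTop_atBot.comp h1)).neg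
    simpa [hG, Function.comp_def] using! h2
  have hint : IntegrableOn (f₂ D a) (Set.Ioi D.τ₂) :=
    integrableOn_Ioi_deriv_of_nonneg' (fun t _ => hderiv t) (fun t _ => hnonneg t) hlim
  have hval : ∫ t in Set.Ioi D.τ₂, f₂ D a t = 0 - G D.τ₂ :=
    integral_Ioi_of_hasDerivAt_of_nonneg' (fun t _ => hderiv t) (fun t _ => hnonneg t) hlim
  rw [setLIntegral_congr Ioi_ae_eq_Ici.symm, ← ofReal_integral_eq_lintegral_ofReal hint
    (Eventually.of_forall hnonneg), hval, ← one_sub_F₂_eq]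
  simp [hG, F₂]

/-- The law of a censored lifetime has density `exp (logDens a ·)` with respect to `refMeasure`. -/
lemma map_obs_lifetimeLaw (hτ₁ : 0 < D.τ₁) (hτ₂ : D.τ₁ < D.τ₂) (a : Param) :
    (lifetimeLaw D a).map (obs D) =
      (refMeasure D).withDensity fun z => ENNReal.ofReal (Real.exp (logDens D a z)) := by
  have hdens : Measurable fun z => ENNReal.ofReal (Real.exp (logDens D a z)) :=
    (continuous_logDens_right D a).measurable.exp.ennreal_ofReal
  refine Measure.ext_of_lintegral _ fun g hg => ?_
  have hm := hdens.mul hg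
  have hgobs : Measurable fun t => g (obs D t) := hg.comp (measurable_obs D)
  rw [lintegral_map hg (measurable_obs D), lifetimeLaw,
    lintegral_withDensity_eq_lintegral_mul _ (measurable_lifetimePDF D a).ennreal_ofReal
      hgobs, lintegral_withDensity_eq_lintegral_mul _ hdens hg,
    refMeasure, lintegral_add_measure, lintegral_add_measure, lintegral_map hm (by fun_prop),
    lintegral_map hm (by fun_prop), lintegral_dirac' _ hm]
  set k : ℝ → ENNReal := (fun t => ENNReal.ofReal (lifetimePDF D a t)) * fun t => g (obs D t)
    with hk
  have hneg : ∫⁻ t in Set.Iio 0, k t = 0 := by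
    rw [setLIntegral_congr_fun (g := fun _ => 0) measurableSet_Iio fun t ht => ?_]
    · simp
    · simp only [hk, Pi.mul_apply, lifetimePDF, if_pos (Set.mem_Iio.1 ht)]
      simp
  have hfirst : ∫⁻ t in Set.Ico 0 D.τ₁, k t = ∫⁻ t in Set.Ioc 0 D.τ₁,
      ENNReal.ofReal (Real.exp (logDens D a (1, 0, t, 0))) * g (1, 0, t, 0) := by
    rw [← setLIntegral_congr (Ico_ae_eq_Ioc (μ := volume) (a := (0 : ℝ)) (b := D.τ₁))]
    refine setLIntegral_congr_fun measurableSet_Ico fun t ht => ?_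
    simp only [hk, Pi.mul_apply, lifetimePDF, if_neg ht.1.not_gt, if_pos ht.2, obs, f₁_eq]
  have hsecond : ∫⁻ t in Set.Ico D.τ₁ D.τ₂, k t = ∫⁻ s in Set.Ioc 0 (D.τ₂ - D.τ₁),
      ENNReal.ofReal (Real.exp (logDens D a (0, 1, D.τ₁, s))) * g (0, 1, D.τ₁, s) := by
    rw [← setLIntegral_congr (Ico_ae_eq_Ioc (μ := volume) (a := (0 : ℝ)) (b := D.τ₂ - D.τ₁))]
    have hpre : Set.Ico D.τ₁ D.τ₂ = (fun t => t - D.τ₁) ⁻¹' Set.Ico 0 (D.τ₂ - D.τ₁) := by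
      ext t
      simp
    have hmp := measurePreserving_sub_right volume D.τ₁
    have hms : Measurable fun s => ENNReal.ofReal (Real.exp (logDens D a (0, 1, D.τ₁, s))) *
        g (0, 1, D.τ₁, s) := hm.comp (by fun_prop : Measurable fun s : ℝ => ((0, 1, D.τ₁, s) : Obs))
    rw [← hmp.setLIntegral_comp_preimage measurableSet_Ico hms, ← hpre]
    refine setLIntegral_congr_fun measurableSet_Ico fun t ht => ?_
    simp only [hk, Pi.mul_apply, lifetimePDF, if_neg (hτ₁.le.trans ht.1).not_gt,
      if_neg ht.1.not_gt, if_pos ht.2, obs, f₂_eq]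
  have hthird : ∫⁻ t in Set.Ici D.τ₂, k t =
      ENNReal.ofReal (Real.exp (logDens D a (0, 0, D.τ₁, D.τ₂ - D.τ₁))) *
        g (0, 0, D.τ₁, D.τ₂ - D.τ₁) := by
    rw [← lintegral_f₂_Ici, ← lintegral_mul_const _ (by unfold f₂; fun_prop)]
    refine setLIntegral_congr_fun measurableSet_Ici fun t ht => ?_
    have h1 : D.τ₁ ≤ t := hτ₂.le.trans ht
    simp only [hk, Pi.mul_apply, lifetimePDF, if_neg (hτ₁.le.trans h1).not_gt,
      if_neg h1.not_gt, if_neg (Set.mem_Ici.1 ht).not_gt, obs]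
  have hsplit : ∫⁻ t, k t = (∫⁻ t in Set.Ico 0 D.τ₁, k t) + (∫⁻ t in Set.Ico D.τ₁ D.τ₂, k t)
      + ∫⁻ t in Set.Ici D.τ₂, k t := by
    rw [← lintegral_add_compl k (measurableSet_Iio (a := (0 : ℝ))), hneg, zero_add, Set.compl_Iio,
      ← Set.Ico_union_Ici_eq_Ici hτ₁.le, lintegral_union measurableSet_Ici,
      ← Set.Ico_union_Ici_eq_Ici hτ₂.le, lintegral_union measurableSet_Ici, add_assoc]
    · exact Set.disjoint_left.2 fun t h1 h2 => (not_lt.2 h2) h1.2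
    · exact Set.disjoint_left.2 fun t h1 h2 => (not_lt.2 h2) h1.2
  simp only [Pi.mul_apply]
  rw [hsplit, hfirst, hsecond, hthird]

variable {D}

lemma ae_nonneg_lifetimeLaw (a : Param) : ∀ᵐ t ∂(lifetimeLaw D a), 0 ≤ t := by
  rw [lifetimeLaw, ae_withDensity_iff (measurable_lifetimePDF D a).ennreal_ofReal]
  refine Eventually.of_forall fun t ht => not_lt.1 fun h => ht ?_
  simp [lifetimePDF, h]

lemma ae_ne_lifetimeLaw (a : Param) (r : ℝ) : ∀ᵐ t ∂(lifetimeLaw D a), t ≠ r :=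
  (withDensity_absolutelyContinuous _ _).ae_le (compl_mem_ae_iff.2 (measure_singleton r))

end SSALT

/-! ### Exponential moments -/

namespace SSALT

/-- Truncated exponential moments up to order two: for the density `t ↦ exp (-(v + t exp (-v)))`
to the power `c`, the mean of a quadratic polynomial in `t exp (-v)` over `[0, τ]`. -/
lemma integral_quadratic_mul_exp (v τ : ℝ) {c : ℝ} (hc : c ≠ 0) (k₀ k₁ k₂ : ℝ) :
    ∫ t in (0 : ℝ)..τ, (k₀ + k₁ * (t * Real.exp (-v)) + k₂ * (t * Real.exp (-v)) ^ 2) *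
        Real.exp (-(c * (v + t * Real.exp (-v)))) =
      Real.exp (-((c - 1) * v)) *
        (k₀ / c * (1 - Real.exp (-(c * (τ * Real.exp (-v)))))
          + k₁ / c ^ 2 * (1 - Real.exp (-(c * (τ * Real.exp (-v)))) * (c * (τ * Real.exp (-v)) + 1))
          + k₂ / c ^ 3 * (2 - Real.exp (-(c * (τ * Real.exp (-v)))) *
            ((c * (τ * Real.exp (-v))) ^ 2 + 2 * (c * (τ * Real.exp (-v))) + 2))) := by
  set w := Real.exp (-v) with hw
  set F : ℝ → ℝ := fun t => -(Real.exp (-((c - 1) * v)) * (Real.exp (-(c * (t * w))) *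
    (k₀ / c + k₁ / c ^ 2 * (c * (t * w) + 1)
      + k₂ / c ^ 3 * ((c * (t * w)) ^ 2 + 2 * (c * (t * w)) + 2)))) with hF
  have hx : ∀ t : ℝ, HasDerivAt (fun t => c * (t * w)) (c * w) t := fun t => by
    simpa using ((hasDerivAt_id t).mul_const w).const_mul c
  have hderiv : ∀ t ∈ Set.uIcc 0 τ, HasDerivAt F
      ((k₀ + k₁ * (t * w) + k₂ * (t * w) ^ 2) * Real.exp (-(c * (v + t * w)))) t := fun t _ => by
    have hpoly := (((hx t).add_const 1).const_mul (k₁ / c ^ 2)).const_add (k₀ / c)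
    have hpoly2 := ((((hx t).fun_pow 2).fun_add ((hx t).const_mul 2)).add_const 2).const_mul
      (k₂ / c ^ 3)
    have h := ((((hx t).fun_neg.exp).fun_mul (hpoly.fun_add hpoly2)).const_mul
      (Real.exp (-((c - 1) * v)))).fun_neg
    refine h.congr_deriv ?_
    have he : Real.exp (-(c * (v + t * w))) =
        Real.exp (-((c - 1) * v)) * w * Real.exp (-(c * (t * w))) := by
      rw [hw, ← Real.exp_add, ← Real.exp_add]
      congr 1
      ring
    rw [he]
    field_simp
    ring
  rw [intervalIntegral.integral_eq_sub_of_hasDerivAt hderiv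
    (Continuous.intervalIntegrable (by fun_prop) _ _)]
  simp only [hF, zero_mul, mul_zero, neg_zero, Real.exp_zero]
  field_simp
  ring

variable (D : Design)

/-- The gradient of `logDens` with respect to the parameter. -/
def score (a : Param) (z : Obs) : Param :=
  (-z.1 + z.2.2.1 * Real.exp (-logScale₁ D a)) • dir₁ D
    + (-z.2.1 + z.2.2.2 * Real.exp (-logScale₂ D a)) • dir₂ D

lemma continuous_score : Continuous fun p : Param × Obs => score D p.1 p.2 := by
  unfold score
  fun_prop

lemma continuous_score_right (a : Param) : Continuous (score D a) := by
  unfold score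
  fun_prop

lemma inner_score (a : Param) (z : Obs) (s : Param) : inner ℝ (score D a z) s =
    (-z.1 + z.2.2.1 * Real.exp (-logScale₁ D a)) * logScale₁ D s
      + (-z.2.1 + z.2.2.2 * Real.exp (-logScale₂ D a)) * logScale₂ D s := by
  simp [score, inner_add_left, inner_smul_left, logScale₁, logScale₂]

section Moments

variable {D}

/-- Moments of the `(β + 1)`-st power of the model density, for a weight that is quadratic in the
normalised time spent under the stress at which the failure occurs. -/
lemma integral_exp_mul_quadratic (hτ₁ : 0 < D.τ₁) (hτ₂ : D.τ₁ < D.τ₂) {β : ℝ} (hβ : 0 ≤ β)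
    (a : Param) {f : Obs → ℝ} (hf : Continuous f) {k₀ k₁ k₂ l₀ l₁ l₂ d X Y r₁ r₂ : ℝ}
    (hX : X = D.τ₁ * Real.exp (-logScale₁ D a))
    (hY : Y = (D.τ₂ - D.τ₁) * Real.exp (-logScale₂ D a))
    (hr₁ : r₁ = Real.exp (-((β + 1) * X))) (hr₂ : r₂ = Real.exp (-((β + 1) * Y)))
    (hk : ∀ t, f (1, 0, t, 0) = k₀ + k₁ * (t * Real.exp (-logScale₁ D a))
      + k₂ * (t * Real.exp (-logScale₁ D a)) ^ 2)
    (hl : ∀ s, f (0, 1, D.τ₁, s) = l₀ + l₁ * (s * Real.exp (-logScale₂ D a))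
      + l₂ * (s * Real.exp (-logScale₂ D a)) ^ 2)
    (hd : f (0, 0, D.τ₁, D.τ₂ - D.τ₁) = d) :
    ∫ z, Real.exp ((β + 1) * logDens D a z) * f z ∂(refMeasure D) =
      Real.exp (-(β * logScale₁ D a)) *
        (k₀ / (β + 1) * (1 - r₁) + k₁ / (β + 1) ^ 2 * (1 - r₁ * ((β + 1) * X + 1))
          + k₂ / (β + 1) ^ 3 * (2 - r₁ * (((β + 1) * X) ^ 2 + 2 * ((β + 1) * X) + 2)))
      + r₁ * (Real.exp (-(β * logScale₂ D a)) *
        (l₀ / (β + 1) * (1 - r₂) + l₁ / (β + 1) ^ 2 * (1 - r₂ * ((β + 1) * Y + 1))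
          + l₂ / (β + 1) ^ 3 * (2 - r₂ * (((β + 1) * Y) ^ 2 + 2 * ((β + 1) * Y) + 2))))
      + r₁ * r₂ * d := by
  have hc : β + 1 ≠ 0 := by positivity
  have hcont := continuous_logDens_right D a
  rw [integral_refMeasure D hτ₁ hτ₂ (by fun_prop)]
  congr 1
  · congr 1
    · have h := integral_quadratic_mul_exp (logScale₁ D a) D.τ₁ hc k₀ k₁ k₂
      rw [← hX, ← hr₁, add_sub_cancel_right] at h
      rw [← h]
      refine intervalIntegral.integral_congr fun t _ => ?_
      simp only [hk, logDens]
      rw [mul_comm]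
      congr 2
      ring
    · have h := integral_quadratic_mul_exp (logScale₂ D a) (D.τ₂ - D.τ₁) hc l₀ l₁ l₂
      rw [← hY, ← hr₂, add_sub_cancel_right] at h
      rw [← h, ← intervalIntegral.integral_const_mul]
      refine intervalIntegral.integral_congr fun t _ => ?_
      simp only [hl, logDens]
      have he : Real.exp ((β + 1) * -(0 * logScale₁ D a + 1 * logScale₂ D a
          + D.τ₁ * Real.exp (-logScale₁ D a) + t * Real.exp (-logScale₂ D a))) = r₁ *
          Real.exp (-((β + 1) * (logScale₂ D a + t * Real.exp (-logScale₂ D a)))) := by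
        rw [hr₁, hX, ← Real.exp_add]
        congr 1
        ring
      rw [he]
      ring
  · rw [hd, hr₁, hr₂, ← Real.exp_add, logDens, hX, hY]
    congr 2
    ring

lemma integral_exp_logDens (hτ₁ : 0 < D.τ₁) (hτ₂ : D.τ₁ < D.τ₂) (a : Param) :
    ∫ z, Real.exp (logDens D a z) ∂(refMeasure D) = 1 := by
  have h := integral_exp_mul_quadratic hτ₁ hτ₂ le_rfl a (f := fun _ => 1) continuous_const
    (k₀ := 1) (k₁ := 0) (k₂ := 0) (l₀ := 1) (l₁ := 0) (l₂ := 0) rfl rfl rfl rfl (by simp)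
    (by simp) rfl
  simp only [zero_add, one_mul, mul_one] at h
  rw [h]
  norm_num
  ring

/-- The quantities that enter `J_β` and `ξ_β`, in terms of the normalised lengths `X` and `Y` of the
two stages and of `V = τ₁ / λ₂`. The shift `h` only occurs through `h / λ₂ = X - V`. -/
lemma auxiliary_closed_forms (β : ℝ) (a : Param) {X Y V r₁ r₂ : ℝ}
    (hX : X = D.τ₁ * Real.exp (-logScale₁ D a))
    (hY : Y = (D.τ₂ - D.τ₁) * Real.exp (-logScale₂ D a))
    (hV : V = D.τ₁ * Real.exp (-logScale₂ D a))
    (hr₁ : r₁ = Real.exp (-((β + 1) * X))) (hr₂ : r₂ = Real.exp (-((β + 1) * Y))) :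
    L D a = -1 - V + X ∧ Lstar D a = -D.x₂ - V * D.x₂ + X * D.x₁ ∧ S D a = X + Y ∧
    Sstar D a = Y * D.x₂ + X * D.x₁ ∧ Real.exp (-(S D a * (β + 1))) = r₁ * r₂ ∧
    M₀ D β a = Real.exp (-(β * logScale₂ D a)) / (β + 1) * (r₁ * (1 - r₂)) ∧
    M₁ D β a = Real.exp (-(β * logScale₂ D a)) / (β + 1) ^ 2 *
      (r₁ * ((V * (β + 1) + 1) - r₂ * ((V + Y) * (β + 1) + 1))) ∧
    M₂ D β a = Real.exp (-(β * logScale₂ D a)) / (β + 1) ^ 3 *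
      (r₁ * (((V * (β + 1)) ^ 2 + 2 * (V * (β + 1)) + 2)
        - r₂ * (((V + Y) * (β + 1)) ^ 2 + 2 * ((V + Y) * (β + 1)) + 2))) ∧
    JFirst D β a = Real.exp (-(β * logScale₁ D a)) / (β + 1) *
      (r₁ * (-1 - 1 / (β + 1) ^ 2 * ((X * (β + 1)) ^ 2 + 2 * (X * (β + 1)) + 2)
        + 2 / (β + 1) * (X * (β + 1) + 1)) + 1 + 2 / (β + 1) ^ 2 - 2 / (β + 1)) ∧
    ξFirst D β a = -(Real.exp (-(β * logScale₁ D a)) / (β + 1)) * (1 - r₁)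
      + Real.exp (-(β * logScale₁ D a)) / (β + 1) ^ 2 * (1 - r₁ * (X * (β + 1) + 1)) := by
  have hdiv₁ : ∀ y : ℝ, y / scale₁ D a = y * Real.exp (-logScale₁ D a) := fun y => by
    rw [scale₁_eq, Real.exp_neg, div_eq_mul_inv]
  have hdiv₂ : ∀ y : ℝ, y / scale₂ D a = y * Real.exp (-logScale₂ D a) := fun y => by
    rw [scale₂_eq, Real.exp_neg, div_eq_mul_inv]
  have hpow₁ : ∀ k : ℝ, 1 / (scale₁ D a ^ β * k) =
      Real.exp (-(β * logScale₁ D a)) / k := fun k => by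
    rw [scale₁_eq, ← Real.exp_mul, one_div, mul_inv, ← Real.exp_neg, div_eq_mul_inv,
      mul_comm β]
  have hpow₂ : ∀ k : ℝ, 1 / (scale₂ D a ^ β * k) =
      Real.exp (-(β * logScale₂ D a)) / k := fun k => by
    rw [scale₂_eq, ← Real.exp_mul, one_div, mul_inv, ← Real.exp_neg, div_eq_mul_inv,
      mul_comm β]
  have hshift : shift D a * Real.exp (-logScale₂ D a) = X - V := by
    have h := cumHazard_eq D a 0
    rw [hdiv₂] at h
    rw [hX, hV]
    linarith
  have hS : S D a = X + Y := by
    rw [S, hdiv₂, add_mul, hshift, hV, hY]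
    ring
  have hτ₂' : D.τ₂ * Real.exp (-logScale₂ D a) = V + Y := by
    rw [hV, hY]
    ring
  have he₁ : Real.exp (-((X - V) * (β + 1))) * Real.exp (-(V * (β + 1))) = r₁ := by
    rw [hr₁, ← Real.exp_add]
    congr 1
    ring
  have he₂ : Real.exp (-((X - V) * (β + 1))) * Real.exp (-((V + Y) * (β + 1))) = r₁ * r₂ := by
    rw [hr₁, hr₂, ← Real.exp_add, ← Real.exp_add]
    congr 1
    ring
  have hrX : Real.exp (-(X * (β + 1))) = r₁ := by rw [hr₁, mul_comm X]
  refine ⟨?_, ?_, hS, ?_, ?_, ?_, ?_, ?_, ?_, ?_⟩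
  · rw [L, hdiv₁, hdiv₂, ← hX, ← hV]
  · rw [Lstar, hdiv₁, hdiv₂, ← hX, ← hV]
  · rw [Sstar, hdiv₁, hdiv₂, hdiv₂, ← hX, ← hV, hτ₂']
    ring
  · rw [hS, hr₁, hr₂, ← Real.exp_add]
    congr 1
    ring
  · rw [M₀, hpow₂, hdiv₂, hdiv₂, hdiv₂, ← hV, hτ₂', hshift]
    linear_combination (Real.exp (-(β * logScale₂ D a)) / (β + 1)) * (he₁ - he₂)
  · rw [M₁, hpow₂, hdiv₂, hdiv₂, hdiv₂, ← hV, hτ₂', hshift]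
    linear_combination (Real.exp (-(β * logScale₂ D a)) / (β + 1) ^ 2) *
      ((V * (β + 1) + 1) * he₁ - ((V + Y) * (β + 1) + 1) * he₂)
  · rw [M₂, hpow₂, mul_div_assoc 2 D.τ₁, mul_div_assoc 2 D.τ₂, hdiv₂, hdiv₂, hdiv₂, ← hV, hτ₂',
      hshift]
    linear_combination (Real.exp (-(β * logScale₂ D a)) / (β + 1) ^ 3) *
      (((V * (β + 1)) ^ 2 + 2 * (V * (β + 1)) + 2) * he₁
        - (((V + Y) * (β + 1)) ^ 2 + 2 * ((V + Y) * (β + 1)) + 2) * he₂)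
  · rw [JFirst, hpow₁, mul_div_assoc 2 D.τ₁, hdiv₁, ← hX, hrX, mul_assoc 2 X]
  · rw [ξFirst, hpow₁, hpow₁, hdiv₁, ← hX, hrX]

/-- The vector `ξ_β` consists of the first moments of the score under the power density. -/
lemma integral_exp_mul_inner_score (hτ₁ : 0 < D.τ₁) (hτ₂ : D.τ₁ < D.τ₂) {β : ℝ} (hβ : 0 ≤ β)
    (a s : Param) :
    ∫ z, Real.exp ((β + 1) * logDens D a z) * inner ℝ (score D a z) s ∂(refMeasure D) =
      ξ D β a ⬝ᵥ s := by
  obtain ⟨hL, hLs, hS, hSs, hE, hM₀, hM₁, -, -, hξ⟩ :=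
    auxiliary_closed_forms (D := D) β a rfl rfl rfl rfl rfl
  have hcont := continuous_score_right D a
  set p := logScale₁ D s with hp
  set q := logScale₂ D s with hq
  rw [integral_exp_mul_quadratic hτ₁ hτ₂ hβ a (by fun_prop) rfl rfl rfl rfl
    (k₀ := -p) (k₁ := p) (k₂ := 0) (l₀ := D.τ₁ * Real.exp (-logScale₁ D a) * p - q) (l₁ := q)
    (l₂ := 0) (d := D.τ₁ * Real.exp (-logScale₁ D a) * p
      + (D.τ₂ - D.τ₁) * Real.exp (-logScale₂ D a) * q)
    (fun t => by rw [inner_score]; ring) (fun t => by rw [inner_score]; ring)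
    (by rw [inner_score]; ring)]
  have hc : β + 1 ≠ 0 := by positivity
  simp only [ξ, hE]
  simp only [dotProduct, Fin.sum_univ_two, Matrix.cons_val_zero, Matrix.cons_val_one, hL, hLs, hS,
    hSs, hM₀, hM₁, hξ, hp, hq, logScale₁_apply D s, logScale₂_apply D s]
  field_simp
  ring

open Matrix in
/-- The matrix `J_β` consists of the second moments of the score under the power density. -/
lemma integral_exp_mul_inner_score_mul (hτ₁ : 0 < D.τ₁) (hτ₂ : D.τ₁ < D.τ₂) {β : ℝ} (hβ : 0 ≤ β)
    (a s s' : Param) :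
    ∫ z, Real.exp ((β + 1) * logDens D a z) *
        (inner ℝ (score D a z) s * inner ℝ (score D a z) s') ∂(refMeasure D) =
      s ⬝ᵥ J D β a *ᵥ s' := by
  obtain ⟨hL, hLs, hS, hSs, hE, hM₀, hM₁, hM₂, hJ, -⟩ :=
    auxiliary_closed_forms (D := D) β a rfl rfl rfl rfl rfl
  have hcont := continuous_score_right D a
  set p := logScale₁ D s with hp
  set q := logScale₂ D s with hq
  set p' := logScale₁ D s' with hp'
  set q' := logScale₂ D s' with hq'
  set X := D.τ₁ * Real.exp (-logScale₁ D a) with hX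
  set Y := (D.τ₂ - D.τ₁) * Real.exp (-logScale₂ D a) with hY
  rw [integral_exp_mul_quadratic hτ₁ hτ₂ hβ a (by fun_prop) hX hY rfl rfl
    (k₀ := p * p') (k₁ := -(2 * (p * p'))) (k₂ := p * p') (l₀ := (X * p - q) * (X * p' - q'))
    (l₁ := q * (X * p' - q') + (X * p - q) * q') (l₂ := q * q')
    (d := (X * p + Y * q) * (X * p' + Y * q'))
    (fun t => by rw [inner_score, inner_score]; ring)
    (fun t => by rw [inner_score, inner_score, ← hX]; ring)
    (by rw [inner_score, inner_score, ← hX, ← hY]; ring)]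
  have hc : β + 1 ≠ 0 := by positivity
  simp only [J, J₀₀, J₀₁, J₁₁, hE]
  simp only [dotProduct, mulVec, Fin.sum_univ_two, Matrix.of_apply, Matrix.cons_val',
    Matrix.cons_val_zero, Matrix.cons_val_one, Matrix.cons_val_fin_one, hL, hLs, hS, hSs, hM₀, hM₁, hM₂, hJ, hp, hq, hp', hq',
    logScale₁_apply D s, logScale₂_apply D s, logScale₁_apply D s', logScale₂_apply D s']
  field_simp
  ring

end Moments

end SSALT

/-! ### The contrast and its derivatives -/

namespace SSALT

open MEstimation

section Derivatives

variable (D : Design)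

lemma hasFDerivAt_logDens (a : Param) (z : Obs) :
    HasFDerivAt (fun a => logDens D a z) (innerSL ℝ (score D a z)) a := by
  have h₁ := (logScale₁ D).hasFDerivAt (x := a)
  have h₂ := (logScale₂ D).hasFDerivAt (x := a)
  have h := ((((h₁.const_mul z.1).fun_add (h₂.const_mul z.2.1)).fun_add
    ((h₁.fun_neg.exp).const_mul z.2.2.1)).fun_add ((h₂.fun_neg.exp).const_mul z.2.2.2)).fun_neg
  refine h.congr_fderiv ?_
  ext s
  simp only [innerSL_apply_apply, inner_score]
  simp
  ring

/-- The derivative of the score with respect to the parameter. -/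
def scoreDeriv (a : Param) (z : Obs) : Param →L[ℝ] Param :=
  -((z.2.2.1 * Real.exp (-logScale₁ D a)) • (logScale₁ D).smulRight (dir₁ D)
    + (z.2.2.2 * Real.exp (-logScale₂ D a)) • (logScale₂ D).smulRight (dir₂ D))

lemma hasFDerivAt_score (a : Param) (z : Obs) :
    HasFDerivAt (fun a => score D a z) (scoreDeriv D a z) a := by
  have h₁ := ((((logScale₁ D).hasFDerivAt (x := a)).fun_neg.exp.const_mul z.2.2.1).const_add
    (-z.1)).smul_const (dir₁ D)
  have h₂ := ((((logScale₂ D).hasFDerivAt (x := a)).fun_neg.exp.const_mul z.2.2.2).const_add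
    (-z.2.1)).smul_const (dir₂ D)
  refine (h₁.fun_add h₂).congr_fderiv ?_
  ext s
  simp [scoreDeriv, smul_smul]
  ring

/-- The rank-one operator `s ↦ ⟨score, s⟩ • score`. -/
def scoreOuter (a : Param) (z : Obs) : Param →L[ℝ] Param :=
  ContinuousLinearMap.smulRightL ℝ Param Param (innerSL ℝ (score D a z)) (score D a z)

lemma scoreOuter_apply (a : Param) (z : Obs) (s : Param) :
    scoreOuter D a z s = inner ℝ (score D a z) s • score D a z := by
  simp [scoreOuter]

lemma continuous_scoreOuter : Continuous fun p : Param × Obs => scoreOuter D p.1 p.2 := by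
  have := continuous_score D
  unfold scoreOuter
  fun_prop

lemma continuous_scoreOuter_right (a : Param) : Continuous (scoreOuter D a) := by
  have := continuous_score_right D a
  unfold scoreOuter
  fun_prop

/-- The score weighted by the power `κ` of the density. -/
def powerScore (κ : ℝ) (a : Param) (z : Obs) : Param :=
  Real.exp (κ * logDens D a z) • score D a z

lemma continuous_powerScore (κ : ℝ) : Continuous fun p : Param × Obs => powerScore D κ p.1 p.2 := by
  have := continuous_score D
  have := continuous_logDens D
  unfold powerScore
  fun_prop

lemma continuous_powerScore_right (κ : ℝ) (a : Param) : Continuous (powerScore D κ a) :=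
  (continuous_powerScore D κ).comp (continuous_const.prodMk continuous_id)

/-- The derivative of the weighted score with respect to the parameter. -/
def powerScoreDeriv (κ : ℝ) (a : Param) (z : Obs) : Param →L[ℝ] Param :=
  Real.exp (κ * logDens D a z) • (κ • scoreOuter D a z + scoreDeriv D a z)

lemma continuous_powerScoreDeriv (κ : ℝ) :
    Continuous fun p : Param × Obs => powerScoreDeriv D κ p.1 p.2 := by
  have := continuous_scoreOuter D
  have := continuous_logDens D
  unfold powerScoreDeriv scoreDeriv
  fun_prop

lemma continuous_powerScoreDeriv_right (κ : ℝ) (a : Param) : Continuous (powerScoreDeriv D κ a) :=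
  (continuous_powerScoreDeriv D κ).comp (continuous_const.prodMk continuous_id)

lemma hasFDerivAt_exp_mul_logDens (κ : ℝ) (a : Param) (z : Obs) :
    HasFDerivAt (fun a => Real.exp (κ * logDens D a z)) (innerSL ℝ (κ • powerScore D κ a z)) a := by
  refine ((hasFDerivAt_logDens D a z).const_mul κ).exp.congr_fderiv ?_
  ext s
  simp [powerScore]
  ring

lemma hasFDerivAt_powerScore (κ : ℝ) (a : Param) (z : Obs) :
    HasFDerivAt (fun a => powerScore D κ a z) (powerScoreDeriv D κ a z) a := by
  refine ((hasFDerivAt_exp_mul_logDens D κ a z).fun_smul (hasFDerivAt_score D a z)).congr_fderiv ?_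
  ext1 s
  simp [powerScoreDeriv, scoreOuter_apply, powerScore, smul_smul]
  module

/-- The function `x ↦ (exp (β x) - 1) / β`, with its limit `x` for `β = 0`. -/
def expQuotient (β x : ℝ) : ℝ := if β = 0 then x else (Real.exp (β * x) - 1) / β

lemma hasDerivAt_expQuotient (β x : ℝ) : HasDerivAt (expQuotient β) (Real.exp (β * x)) x := by
  unfold expQuotient
  split_ifs with h
  · simpa [h] using hasDerivAt_id' x
  · have h1 := (((hasDerivAt_id x).const_mul β).exp.sub_const 1).div_const β
    refine h1.congr_deriv ?_
    simp
    field_simp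

lemma continuous_expQuotient (β : ℝ) : Continuous (expQuotient β) :=
  continuous_iff_continuousAt.2 fun x => (hasDerivAt_expQuotient β x).continuousAt

/-- The integral of the `(β + 1)`-st power of the model density. -/
def meanPower (β : ℝ) (a : Param) : ℝ :=
  ∫ z, Real.exp ((β + 1) * logDens D a z) ∂(refMeasure D)

/-- The contribution of one observation to the loss, normalised in such a way that it is
continuous in `β` at `β = 0`. -/
def contrast (β : ℝ) (a : Param) (z : Obs) : ℝ :=
  meanPower D β a - (β + 1) * expQuotient β (logDens D a z)

/-- The gradient of the contrast. -/
def contrastGrad (β : ℝ) (a : Param) (z : Obs) : Param :=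
  (β + 1) • (∫ y, powerScore D (β + 1) a y ∂(refMeasure D) - powerScore D β a z)

/-- The Hessian of the contrast. -/
def contrastHess (β : ℝ) (a : Param) (z : Obs) : Param →L[ℝ] Param :=
  (β + 1) • (∫ y, powerScoreDeriv D (β + 1) a y ∂(refMeasure D) - powerScoreDeriv D β a z)

variable {D}

lemma integrable_refMeasure {W : Type*} [NormedAddCommGroup W] (hτ₁ : 0 < D.τ₁) (hτ₂ : D.τ₁ < D.τ₂)
    {f : Obs → W} (hf : Continuous f) : Integrable f (refMeasure D) :=
  hf.integrable_of_ae_mem_isCompact (isCompact_obsRange D) (ae_refMeasure_mem D hτ₁ hτ₂)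

lemma meanPower_zero (hτ₁ : 0 < D.τ₁) (hτ₂ : D.τ₁ < D.τ₂) (a : Param) : meanPower D 0 a = 1 := by
  simpa [meanPower] using integral_exp_logDens hτ₁ hτ₂ a

lemma hasFDerivAt_meanPower (hτ₁ : 0 < D.τ₁) (hτ₂ : D.τ₁ < D.τ₂) (β : ℝ) (a : Param) :
    HasFDerivAt (meanPower D β)
      (innerSL ℝ ((β + 1) • ∫ y, powerScore D (β + 1) a y ∂(refMeasure D))) a := by
  have hp := continuous_powerScore D (β + 1)
  have hd : ∀ a, Continuous (logDens D a) := continuous_logDens_right D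
  have h := hasFDerivAt_integral_of_isCompact (μ := refMeasure D)
    (fun a z => hasFDerivAt_exp_mul_logDens D (β + 1) a z) (fun a => by fun_prop) (by fun_prop)
    (isCompact_obsRange D) (ae_refMeasure_mem D hτ₁ hτ₂) a
  refine h.congr_fderiv ?_
  rw [← integral_smul, ContinuousLinearMap.integral_comp_comm]
  exact (integrable_refMeasure hτ₁ hτ₂ (continuous_powerScore_right D _ a)).smul (β + 1)

lemma hasFDerivAt_contrast (hτ₁ : 0 < D.τ₁) (hτ₂ : D.τ₁ < D.τ₂) (β : ℝ) (a : Param) (z : Obs) :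
    HasFDerivAt (fun a => contrast D β a z) (innerSL ℝ (contrastGrad D β a z)) a := by
  have h := (hasFDerivAt_meanPower hτ₁ hτ₂ β a).fun_sub
    (((hasDerivAt_expQuotient β (logDens D a z)).comp_hasFDerivAt a
      (hasFDerivAt_logDens D a z)).const_mul (β + 1))
  refine h.congr_fderiv ?_
  ext s
  simp [contrastGrad, powerScore]
  ring

lemma hasFDerivAt_contrastGrad (hτ₁ : 0 < D.τ₁) (hτ₂ : D.τ₁ < D.τ₂) (β : ℝ) (a : Param) (z : Obs) :
    HasFDerivAt (fun a => contrastGrad D β a z) (contrastHess D β a z) a := by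
  have h := hasFDerivAt_integral_of_isCompact (μ := refMeasure D)
    (fun a z => hasFDerivAt_powerScore D (β + 1) a z)
    (fun a => continuous_powerScore_right D (β + 1) a) (continuous_powerScoreDeriv D (β + 1))
    (isCompact_obsRange D) (ae_refMeasure_mem D hτ₁ hτ₂) a
  exact (h.fun_sub (hasFDerivAt_powerScore D β a z)).const_smul (β + 1)

lemma continuous_contrast (hτ₁ : 0 < D.τ₁) (hτ₂ : D.τ₁ < D.τ₂) (β : ℝ) :
    Continuous fun p : Param × Obs => contrast D β p.1 p.2 := by
  have h1 : Continuous (meanPower D β) :=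
    continuous_iff_continuousAt.2 fun a => (hasFDerivAt_meanPower hτ₁ hτ₂ β a).continuousAt
  have h2 := continuous_logDens D
  have h3 := continuous_expQuotient β
  unfold contrast
  fun_prop

lemma continuous_contrastHess (hτ₁ : 0 < D.τ₁) (hτ₂ : D.τ₁ < D.τ₂) (β : ℝ) :
    Continuous fun p : Param × Obs => contrastHess D β p.1 p.2 := by
  have h1 := continuous_integral_of_isCompact (μ := refMeasure D)
    (continuous_powerScoreDeriv D (β + 1)) (isCompact_obsRange D) (ae_refMeasure_mem D hτ₁ hτ₂)
  have h2 := continuous_powerScoreDeriv D β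
  exact ((h1.comp continuous_fst).sub h2).const_smul (β + 1)

end Derivatives

/-! ### The matrix of second moments of the score -/

section Matrices

variable {D : Design}

open Matrix

lemma transpose_J (β : ℝ) (a : Param) : (J D β a)ᵀ = J D β a := by
  ext i j
  fin_cases i <;> fin_cases j <;> simp [J]

lemma eq_zero_of_logScale_eq_zero (hx : D.x₁ < D.x₂) {s : Param} (h₁ : logScale₁ D s = 0)
    (h₂ : logScale₂ D s = 0) : s = 0 := by
  rw [logScale₁_apply] at h₁
  rw [logScale₂_apply] at h₂
  have hs1 : s 1 = 0 := by
    have : s 1 * (D.x₂ - D.x₁) = 0 := by linarith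
    exact (mul_eq_zero.1 this).resolve_right (sub_pos.2 hx).ne'
  have hs0 : s 0 = 0 := by simpa [hs1] using h₁
  ext i
  fin_cases i <;> [exact hs0; exact hs1]

/-- The quadratic form of `J_β` is the integral of a square that vanishes identically only in the
direction `0`. -/
lemma isUnit_det_J (hx : D.x₁ < D.x₂) (hτ₁ : 0 < D.τ₁) (hτ₂ : D.τ₁ < D.τ₂) {β : ℝ} (hβ : 0 ≤ β)
    (a : Param) : IsUnit (J D β a).det := by
  rw [isUnit_iff_ne_zero]
  intro hdet
  obtain ⟨v, hv, hJv⟩ := Matrix.exists_mulVec_eq_zero_iff.2 hdet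
  set s : Param := WithLp.toLp 2 v with hs
  have hint := integral_exp_mul_inner_score_mul hτ₁ hτ₂ hβ a s s
  have hcd := continuous_logDens_right D a
  have hcs := continuous_score_right D a
  set f : Obs → ℝ := fun z => Real.exp ((β + 1) * logDens D a z) *
    (inner ℝ (score D a z) s * inner ℝ (score D a z) s) with hf
  have hfc : Continuous f := by fun_prop
  have hf0 : ∀ z, 0 ≤ f z := fun z => mul_nonneg (Real.exp_pos _).le (mul_self_nonneg _)
  have hzero : ∫ z, f z ∂(refMeasure D) = 0 := by
    rw [hint, hJv, dotProduct_zero]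
  have hvanish := mt (integral_refMeasure_pos D hτ₁ hτ₂ hfc hf0) hzero.not_gt
  obtain ⟨hz1, hz2⟩ : f (1, 0, 0, 0) = 0 ∧ f (0, 1, D.τ₁, 0) = 0 := by
    simpa only [not_or, not_ne_iff] using hvanish
  have hp : logScale₁ D s = 0 := by
    simpa [hf, inner_score] using hz1
  have hq : logScale₂ D s = 0 := by
    simpa [hf, inner_score, hp] using hz2
  have hs0 := eq_zero_of_logScale_eq_zero hx hp hq
  exact hv (by simpa [hs] using congrArg WithLp.ofLp hs0)

/-- `J_β` is the operator `∫ f^(β + 1) • (score ⊗ score)`. -/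
lemma integral_smul_scoreOuter (hτ₁ : 0 < D.τ₁) (hτ₂ : D.τ₁ < D.τ₂) {β : ℝ} (hβ : 0 ≤ β)
    (a : Param) :
    ∫ z, Real.exp ((β + 1) * logDens D a z) • scoreOuter D a z ∂(refMeasure D) =
      toEuclideanCLM (𝕜 := ℝ) (J D β a) := by
  have hcd := continuous_logDens_right D a
  have hcs := continuous_score_right D a
  have hco := continuous_scoreOuter_right D a
  have hint : Integrable (fun z => Real.exp ((β + 1) * logDens D a z) • scoreOuter D a z)
      (refMeasure D) := integrable_refMeasure hτ₁ hτ₂ (by fun_prop)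
  refine ContinuousLinearMap.ext fun s => ext_inner_left ℝ fun s' => ?_
  have happly : ∀ z, inner ℝ s' ((Real.exp ((β + 1) * logDens D a z) • scoreOuter D a z) s) =
      Real.exp ((β + 1) * logDens D a z) *
        (inner ℝ (score D a z) s' * inner ℝ (score D a z) s) := fun z => by
    rw [_root_.smul_apply, scoreOuter_apply, inner_smul_right, inner_smul_right,
      real_inner_comm s']
    ring
  rw [ContinuousLinearMap.integral_apply hint, inner_toEuclideanCLM,
    ← integral_exp_mul_inner_score_mul hτ₁ hτ₂ hβ,
    ← integral_inner (hint.apply_continuousLinearMap s)]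
  exact integral_congr_ae (Eventually.of_forall happly)

end Matrices

end SSALT

/-! ### Expectations under the lifetime law -/

namespace SSALT

open MEstimation Matrix

variable {D : Design} {Ω : Type*} [MeasurableSpace Ω] {P : Measure Ω}
  {a : Param}

section OneObservation

variable {X : Ω → ℝ}

lemma integral_comp_obs {W : Type*} [NormedAddCommGroup W] [NormedSpace ℝ W]
    (hτ₁ : 0 < D.τ₁) (hτ₂ : D.τ₁ < D.τ₂) (hX : HasLaw X (lifetimeLaw D a) P) {f : Obs → W}
    (hf : Continuous f) :
    ∫ ω, f (obs D (X ω)) ∂P = ∫ z, Real.exp (logDens D a z) • f z ∂(refMeasure D) := by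
  have h1 : ∫ ω, f (obs D (X ω)) ∂P = ∫ t, f (obs D t) ∂(lifetimeLaw D a) :=
    hX.integral_comp (f := fun t => f (obs D t))
      (hf.aestronglyMeasurable.comp_measurable (measurable_obs D))
  rw [h1, ← integral_map (measurable_obs D).aemeasurable hf.aestronglyMeasurable,
    map_obs_lifetimeLaw D hτ₁ hτ₂, integral_withDensity_eq_integral_toReal_smul]
  · simp only [ENNReal.toReal_ofReal (Real.exp_pos _).le]
  · exact (continuous_logDens_right D a).measurable.exp.ennreal_ofReal
  · exact Eventually.of_forall fun z => ENNReal.ofReal_lt_top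

lemma ae_obs_mem (hτ₁ : 0 < D.τ₁) (hτ₂ : D.τ₁ < D.τ₂) (hX : HasLaw X (lifetimeLaw D a) P) :
    ∀ᵐ ω ∂P, obs D (X ω) ∈ obsRange D := by
  have h : ∀ᵐ ω ∂P, 0 ≤ X ω := by
    have := ae_nonneg_lifetimeLaw (D := D) a
    rw [← hX.map_eq] at this
    exact ae_of_ae_map hX.aemeasurable this
  exact h.mono fun ω hω => obs_mem_obsRange D hτ₁ hτ₂ hω

lemma integral_inner_powerScore (hτ₁ : 0 < D.τ₁) (hτ₂ : D.τ₁ < D.τ₂)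
    (hX : HasLaw X (lifetimeLaw D a) P) {β : ℝ} (hβ : 0 ≤ β) (s : Param) :
    ∫ ω, inner ℝ (powerScore D β a (obs D (X ω))) s ∂P = ξ D β a ⬝ᵥ s := by
  have hp := continuous_powerScore_right D β a
  rw [integral_comp_obs (f := fun z => inner ℝ (powerScore D β a z) s) hτ₁ hτ₂ hX (by fun_prop),
    ← integral_exp_mul_inner_score hτ₁ hτ₂ hβ]
  congr 1 with z
  rw [powerScore, real_inner_smul_left, smul_eq_mul, ← mul_assoc, ← Real.exp_add]
  congr 2
  ring

variable [IsProbabilityMeasure P]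

lemma integrable_comp_obs {W : Type*} [NormedAddCommGroup W]
    (hτ₁ : 0 < D.τ₁) (hτ₂ : D.τ₁ < D.τ₂) (hX : HasLaw X (lifetimeLaw D a) P) {f : Obs → W}
    (hf : Continuous f) : Integrable (fun ω => f (obs D (X ω))) P :=
  integrable_comp_of_continuous (X := fun ω => obs D (X ω)) hf
    ((measurable_obs D).comp_aemeasurable hX.aemeasurable)
    (isCompact_obsRange D) (ae_obs_mem hτ₁ hτ₂ hX)

/-- At the true parameter the mean Hessian of the contrast is `(β + 1) J_β`: the second derivatives
of `logDens` cancel. -/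
lemma integral_contrastHess (hτ₁ : 0 < D.τ₁) (hτ₂ : D.τ₁ < D.τ₂)
    (hX : HasLaw X (lifetimeLaw D a) P) {β : ℝ} (hβ : 0 ≤ β) :
    ∫ ω, contrastHess D β a (obs D (X ω)) ∂P =
      (β + 1) • toEuclideanCLM (𝕜 := ℝ) (J D β a) := by
  have hd := continuous_logDens_right D a
  have hp := continuous_powerScoreDeriv_right D β a
  have hp' := continuous_powerScoreDeriv_right D (β + 1) a
  have hint := integrable_comp_obs hτ₁ hτ₂ hX hp
  simp only [contrastHess]
  rw [integral_smul, integral_sub (integrable_const _) hint, integral_const, probReal_univ,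
    one_smul, integral_comp_obs hτ₁ hτ₂ hX hp, ← integral_sub (integrable_refMeasure hτ₁ hτ₂ hp')
      (integrable_refMeasure hτ₁ hτ₂ (by fun_prop)), ← integral_smul_scoreOuter hτ₁ hτ₂ hβ a]
  congr 2 with z : 1
  simp only [powerScoreDeriv]
  rw [smul_smul, ← Real.exp_add, show logDens D a z + β * logDens D a z = (β + 1) * logDens D a z by
    ring]
  module

/-- `K_β` is the covariance matrix of the weighted score at the true parameter. -/
lemma integral_inner_powerScore_sub_sq (hτ₁ : 0 < D.τ₁) (hτ₂ : D.τ₁ < D.τ₂)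
    (hX : HasLaw X (lifetimeLaw D a) P) {β : ℝ} (hβ : 0 ≤ β) (s : Param) :
    ∫ ω, (inner ℝ (powerScore D β a (obs D (X ω))) s - ξ D β a ⬝ᵥ s) ^ 2 ∂P =
      s ⬝ᵥ K D β a *ᵥ s := by
  have hp := continuous_powerScore_right D β a
  set r := ξ D β a ⬝ᵥ s with hr
  have hi1 := integrable_comp_obs hτ₁ hτ₂ hX
    (f := fun z => inner ℝ (powerScore D β a z) s) (by fun_prop)
  have hi2 := integrable_comp_obs hτ₁ hτ₂ hX
    (f := fun z => (inner ℝ (powerScore D β a z) s) ^ 2) (by fun_prop)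
  have hsq : ∫ ω, (inner ℝ (powerScore D β a (obs D (X ω))) s) ^ 2 ∂P =
      s ⬝ᵥ J D (2 * β) a *ᵥ s := by
    rw [integral_comp_obs (f := fun z => (inner ℝ (powerScore D β a z) s) ^ 2) hτ₁ hτ₂ hX
      (by fun_prop), ← integral_exp_mul_inner_score_mul hτ₁ hτ₂ (by positivity)]
    congr 1 with z
    rw [powerScore, real_inner_smul_left, smul_eq_mul,
      show (2 * β + 1) * logDens D a z = logDens D a z + (β * logDens D a z + β * logDens D a z) by
        ring, Real.exp_add, Real.exp_add]
    ring
  have hexp : ∀ ω, (inner ℝ (powerScore D β a (obs D (X ω))) s - r) ^ 2 =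
      (inner ℝ (powerScore D β a (obs D (X ω))) s) ^ 2
        - 2 * r * inner ℝ (powerScore D β a (obs D (X ω))) s + r ^ 2 := fun ω => by ring
  have hi3 : Integrable (fun ω => (inner ℝ (powerScore D β a (obs D (X ω))) s) ^ 2
      - 2 * r * inner ℝ (powerScore D β a (obs D (X ω))) s) P := hi2.sub (hi1.const_mul _)
  simp only [hexp]
  rw [integral_add hi3 (integrable_const _),
    integral_sub hi2 (hi1.const_mul _), integral_const_mul, hsq,
    integral_inner_powerScore hτ₁ hτ₂ hX hβ, integral_const, probReal_univ, one_smul, ← hr, K,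
    sub_mulVec, dotProduct_sub, vecMulVec_mulVec]
  have : s.ofLp ⬝ᵥ MulOpposite.op (ξ D β a ⬝ᵥ s.ofLp) • ξ D β a = r * r := by
    rw [hr, op_smul_eq_smul, dotProduct_smul, smul_eq_mul, dotProduct_comm s.ofLp]
  rw [this]
  ring

lemma transpose_K (β : ℝ) : (K D β a)ᵀ = K D β a := by
  rw [K, transpose_sub, transpose_J, transpose_vecMulVec]

lemma posSemidef_K (hτ₁ : 0 < D.τ₁) (hτ₂ : D.τ₁ < D.τ₂)
    (hX : HasLaw X (lifetimeLaw D a) P) {β : ℝ} (hβ : 0 ≤ β) : (K D β a).PosSemidef := by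
  refine PosSemidef.of_dotProduct_mulVec_nonneg ?_ fun v => ?_
  · rw [IsHermitian, conjTranspose_eq_transpose_of_trivial, transpose_K]
  · have h := integral_inner_powerScore_sub_sq hτ₁ hτ₂ hX hβ (WithLp.toLp 2 v)
    rw [star_trivial, ← h]
    exact integral_nonneg fun ω => sq_nonneg _

lemma transpose_J_inv (β : ℝ) : ((J D β a)⁻¹)ᵀ = (J D β a)⁻¹ := by
  rw [transpose_nonsing_inv, transpose_J]

lemma posSemidef_asympCov (hτ₁ : 0 < D.τ₁) (hτ₂ : D.τ₁ < D.τ₂)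
    (hX : HasLaw X (lifetimeLaw D a) P) {β : ℝ} (hβ : 0 ≤ β) : (asympCov D β a).PosSemidef := by
  have h := (posSemidef_K hτ₁ hτ₂ hX hβ).mul_mul_conjTranspose_same ((J D β a)⁻¹)
  rwa [conjTranspose_eq_transpose_of_trivial, transpose_J_inv] at h

end OneObservation

section Sample

variable [IsProbabilityMeasure P] {T : ℕ → Ω → ℝ}

/-- The central limit theorem for the influence functions `-(β + 1)⁻¹ J_β⁻¹ ∇contrast`. -/
lemma tendstoInDistribution_influence (hτ₁ : 0 < D.τ₁) (hτ₂ : D.τ₁ < D.τ₂)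
    (hT : ∀ i, HasLaw (T i) (lifetimeLaw D a) P) (hindep : iIndepFun T P) {β : ℝ} (hβ : 0 ≤ β) :
    TendstoInDistribution (fun (N : ℕ) ω => (√N)⁻¹ • ∑ i ∈ Finset.range N,
        -((β + 1)⁻¹ • toEuclideanCLM (𝕜 := ℝ) (J D β a)⁻¹) (contrastGrad D β a (obs D (T i ω))))
      atTop id (fun _ => P) (multivariateGaussian 0 (asympCov D β a)) := by
  have hc : β + 1 ≠ 0 := by positivity
  have hp := continuous_powerScore_right D β a
  set A := toEuclideanCLM (𝕜 := ℝ) (J D β a)⁻¹ with hA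
  set m := ∫ y, powerScore D (β + 1) a y ∂(refMeasure D) with hm
  set g : Obs → Param := fun z => -((β + 1)⁻¹ • A) (contrastGrad D β a z) with hg
  have hgA : ∀ z, g z = A (powerScore D β a z - m) := fun z => by
    rw [hg]
    simp only [contrastGrad, ← hm]
    rw [_root_.smul_apply, map_smul, smul_smul, inv_mul_cancel₀ hc, one_smul, ← map_neg, neg_sub]
  have hgc : Continuous g := by
    rw [funext hgA]
    fun_prop
  have hmξ : ∀ s : Param, inner ℝ m s = ξ D β a ⬝ᵥ s := fun s => by
    rw [← integral_exp_mul_inner_score hτ₁ hτ₂ hβ, real_inner_comm, hm, ← integral_inner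
      (integrable_refMeasure hτ₁ hτ₂ (continuous_powerScore_right D (β + 1) a))]
    congr 1 with z
    rw [powerScore, real_inner_smul_right, real_inner_comm]
  have hAs : ∀ x s : Param, inner ℝ (A x) s = inner ℝ x (A s) := fun x s => by
    rw [real_inner_comm, hA, inner_toEuclideanCLM, inner_toEuclideanCLM, dotProduct_mulVec,
      ← mulVec_transpose, transpose_J_inv, dotProduct_comm]
  have hgs : ∀ z s, inner ℝ (g z) s = inner ℝ (powerScore D β a z) (A s) - ξ D β a ⬝ᵥ A s :=
    fun z s => by rw [hgA, hAs, inner_sub_left, hmξ]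
  have hgm : Measurable fun t => g (obs D t) := hgc.measurable.comp (measurable_obs D)
  have hident : ∀ i, IdentDistrib (T i) (T 0) P P := fun i =>
    ⟨(hT i).aemeasurable, (hT 0).aemeasurable, by rw [(hT i).map_eq, (hT 0).map_eq]⟩
  have hobs := ae_obs_mem hτ₁ hτ₂ (hT 0)
  refine tendstoInDistribution_multivariateGaussian (Y := fun i ω => g (obs D (T i ω)))
    (hindep.comp (fun _ t => g (obs D t)) fun _ => hgm) (fun i => (hident i).comp hgm) ?_ ?_
    (posSemidef_asympCov hτ₁ hτ₂ (hT 0) hβ) ?_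
  · obtain ⟨C, hC⟩ := (isCompact_obsRange D).exists_bound_of_continuousOn hgc.continuousOn
    exact MemLp.of_bound (hgm.comp_aemeasurable (hT 0).aemeasurable).aestronglyMeasurable C
      (hobs.mono fun ω hω => hC _ hω)
  · intro s
    simp only [hgs]
    rw [integral_sub (integrable_comp_obs (f := fun z => inner ℝ (powerScore D β a z) (A s)) hτ₁ hτ₂
      (hT 0) (by fun_prop)) (integrable_const _), integral_inner_powerScore hτ₁ hτ₂ (hT 0) hβ]
    simp
  · intro s
    simp only [hgs]
    rw [integral_inner_powerScore_sub_sq hτ₁ hτ₂ (hT 0) hβ, asympCov, hA, ofLp_toEuclideanCLM,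
      ← mulVec_mulVec, ← mulVec_mulVec, dotProduct_mulVec s.ofLp, ← mulVec_transpose,
      transpose_J_inv]

end Sample

end SSALT

/-! ### Lower bounds for the loss of a single stage -/

namespace SSALT

open MEstimation

/-- Young's inequality in logarithmic coordinates. -/
lemma neg_exp_div_lt_of_ne {β : ℝ} (hβ : 0 < β) {x y : ℝ} (hxy : x ≠ y) :
    -Real.exp ((β + 1) * y) / β <
      Real.exp ((β + 1) * x) - (β + 1) / β * Real.exp (β * x + y) := by
  have h1 : (x - y) + 1 < Real.exp (x - y) := Real.add_one_lt_exp (sub_ne_zero.2 hxy)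
  have h2 : -(β * (x - y)) + 1 ≤ Real.exp (-(β * (x - y))) := Real.add_one_le_exp _
  have h3 : 0 < β * Real.exp (x - y) + Real.exp (-(β * (x - y))) - (β + 1) := by nlinarith
  have e1 : Real.exp ((β + 1) * x) = Real.exp (β * x + y) * Real.exp (x - y) := by
    rw [← Real.exp_add]
    congr 1
    ring
  have e2 : Real.exp ((β + 1) * y) = Real.exp (β * x + y) * Real.exp (-(β * (x - y))) := by
    rw [← Real.exp_add]
    congr 1
    ring
  have h4 : 0 < Real.exp (β * x + y) / β *
      (β * Real.exp (x - y) + Real.exp (-(β * (x - y))) - (β + 1)) := by positivity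
  rw [e1, e2, ← sub_pos]
  refine h4.trans_eq ?_
  field_simp
  ring

lemma neg_exp_div_le {β : ℝ} (hβ : 0 < β) (x y : ℝ) :
    -Real.exp ((β + 1) * y) / β ≤
      Real.exp ((β + 1) * x) - (β + 1) / β * Real.exp (β * x + y) := by
  rcases eq_or_ne x y with rfl | h
  · rw [show β * x + x = (β + 1) * x by ring]
    refine le_of_eq ?_
    field_simp
    ring
  · exact (neg_exp_div_lt_of_ne hβ h).le

/-- Pointwise form of the density power divergence (Kullback–Leibler divergence for `β = 0`):
as a function of `x`, the contrast of the log-density `x` is uniquely minimal at the true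
log-density. -/
lemma contrast_lt_of_ne {β : ℝ} (hβ : 0 ≤ β) {x y : ℝ} (hxy : x ≠ y) :
    Real.exp ((β + 1) * y) - (β + 1) * (Real.exp y * expQuotient β y) <
      Real.exp ((β + 1) * x) - (β + 1) * (Real.exp y * expQuotient β x) := by
  rcases hβ.eq_or_lt with rfl | hβ'
  · have h1 : (x - y) + 1 < Real.exp (x - y) := Real.add_one_lt_exp (sub_ne_zero.2 hxy)
    have e1 : Real.exp x = Real.exp y * Real.exp (x - y) := by
      rw [← Real.exp_add]
      congr 1
      ring
    simp only [expQuotient, if_pos, zero_add, one_mul]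
    rw [e1]
    nlinarith [Real.exp_pos y]
  · have h := neg_exp_div_lt_of_ne hβ' hxy
    have e1 : Real.exp (β * x + y) = Real.exp y * Real.exp (β * x) := by rw [Real.exp_add, mul_comm]
    have e2 : Real.exp ((β + 1) * y) = Real.exp y * Real.exp (β * y) := by
      rw [← Real.exp_add]
      congr 1
      ring
    simp only [expQuotient, if_neg hβ'.ne']
    rw [e1] at h
    have h5 : Real.exp ((β + 1) * y) - (β + 1) * (Real.exp y * ((Real.exp (β * y) - 1) / β)) =
        -Real.exp ((β + 1) * y) / β + (β + 1) / β * Real.exp y := by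
      rw [e2]
      field_simp
      ring
    have h6 : Real.exp ((β + 1) * x) - (β + 1) * (Real.exp y * ((Real.exp (β * x) - 1) / β)) =
        Real.exp ((β + 1) * x) - (β + 1) / β * (Real.exp y * Real.exp (β * x))
          + (β + 1) / β * Real.exp y := by
      field_simp
      ring
    rw [h5, h6]
    linarith

section Stage

/-- The integral over a stage of length `τ` of the `(β + 1)`-st power of an exponential density with
log-scale `v`. -/
def stagePower (β τ v : ℝ) : ℝ := ∫ t in (0 : ℝ)..τ, Real.exp (-((β + 1) * (v + t * Real.exp (-v))))

/-- The contribution of one stage to the loss, if the stage is reached with probability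
`exp (-p)` in the model and `B` is the empirical mean of the `β`-th power of the exponential
density. -/
def stageLoss (β τ p v B : ℝ) : ℝ :=
  Real.exp (-((β + 1) * p)) * stagePower β τ v - (β + 1) / β * (Real.exp (-(β * p)) * B)

lemma stageLoss_anti {β : ℝ} (hβ : 0 < β) {τ p v B B' : ℝ} (h : B ≤ B') :
    stageLoss β τ p v B' ≤ stageLoss β τ p v B := by
  unfold stageLoss
  gcongr

lemma stagePower_eq {β : ℝ} (hβ : 0 < β) (τ v : ℝ) : stagePower β τ v =
    Real.exp (-(β * v)) / (β + 1) * (1 - Real.exp (-((β + 1) * (τ * Real.exp (-v))))) := by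
  have h := integral_quadratic_mul_exp v τ (c := β + 1) (by positivity) 1 0 0
  simp only [zero_mul, add_zero, one_mul, add_sub_cancel_right, zero_div] at h
  rw [stagePower, h]
  ring

lemma stagePower_nonneg {β : ℝ} {τ : ℝ} (hτ : 0 < τ) (v : ℝ) : 0 ≤ stagePower β τ v :=
  intervalIntegral.integral_nonneg hτ.le fun _ _ => (Real.exp_pos _).le

/-- For small scales, the loss of a stage is nearly nonnegative provided the empirical mean is
of smaller order than `exp (-(β - s) v)` with `s > β / (β + 1)`. -/
lemma exists_neg_le_stageLoss {β τ s C ε : ℝ} (hβ : 0 < β) (hτ : 0 < τ) (hs : β < s * (β + 1))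
    (hC : 0 < C) (hε : 0 < ε) :
    ∃ V : ℝ, ∀ p v B, v ≤ V → B ≤ C * Real.exp ((s - β) * v) → -ε ≤ stageLoss β τ p v B := by
  set k := (1 - Real.exp (-((β + 1) * τ))) / (β + 1) with hk
  have hk0 : 0 < k := by
    have : Real.exp (-((β + 1) * τ)) < 1 := by
      rw [Real.exp_lt_one_iff]
      have : 0 < (β + 1) * τ := by positivity
      linarith
    exact div_pos (by linarith) (by positivity)
  set κ := (β + 1) * Real.log C - β * Real.log k with hκ
  have hlim : Tendsto (fun v => Real.exp (κ + (s * (β + 1) - β) * v) / β) atBot (𝓝 0) := by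
    have h1 : Tendsto (fun v => κ + (s * (β + 1) - β) * v) atBot atBot :=
      tendsto_atBot_add_const_left _ _ (tendsto_id.const_mul_atBot (sub_pos.2 hs))
    simpa using (Real.tendsto_exp_atBot.comp h1).div_const β
  obtain ⟨V, hV⟩ := eventually_atBot.1 (hlim.eventually_le_const hε)
  refine ⟨min V 0, fun p v B hv hB => ?_⟩
  have hv0 : v ≤ 0 := hv.trans (min_le_right _ _)
  have hA : Real.exp (Real.log k - β * v) ≤ stagePower β τ v := by
    rw [stagePower_eq hβ, sub_eq_add_neg, Real.exp_add, Real.exp_log hk0, hk, mul_comm,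
      div_mul_eq_mul_div, ← mul_div_assoc]
    have h1 : 1 ≤ Real.exp (-v) := Real.one_le_exp (by linarith)
    gcongr
    nlinarith
  have hB' : B ≤ Real.exp (Real.log C + (s - β) * v) := by
    rwa [Real.exp_add, Real.exp_log hC]
  refine le_trans ?_ (stageLoss_anti hβ hB')
  -- in Young's inequality, `exp ((β + 1) x)` is the lower bound for the integral term and
  -- `exp (β x + y)` the upper bound for the empirical term; then `exp ((β + 1) y)` does not depend
  -- on `p`
  have hy := neg_exp_div_le hβ (-p + (Real.log k - β * v) / (β + 1))
    (Real.log C + (s - β) * v - β * (Real.log k - β * v) / (β + 1))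
  have hc : β + 1 ≠ 0 := by positivity
  rw [show (β + 1) * (-p + (Real.log k - β * v) / (β + 1)) =
      -((β + 1) * p) + (Real.log k - β * v) by field_simp,
    show β * (-p + (Real.log k - β * v) / (β + 1)) +
      (Real.log C + (s - β) * v - β * (Real.log k - β * v) / (β + 1)) =
        -(β * p) + (Real.log C + (s - β) * v) by field_simp; ring,
    show (β + 1) * (Real.log C + (s - β) * v - β * (Real.log k - β * v) / (β + 1)) =
      κ + (s * (β + 1) - β) * v by rw [hκ]; field_simp; ring, Real.exp_add (-((β + 1) * p)),
    Real.exp_add (-(β * p))] at hy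
  have hV' := hV v (hv.trans (min_le_left _ _))
  have h2 : Real.exp (-((β + 1) * p)) * Real.exp (Real.log k - β * v) ≤
      Real.exp (-((β + 1) * p)) * stagePower β τ v := by gcongr
  unfold stageLoss
  rw [neg_div] at hy
  linarith

/-- The population loss of a stage is at least that of the true (sub-)density `exp γ`. -/
lemma neg_integral_div_le_stageLoss {β τ : ℝ} (hβ : 0 < β) (hτ : 0 < τ) {γ : ℝ → ℝ}
    (hγ : Continuous γ) (p v : ℝ) :
    -(∫ t in (0 : ℝ)..τ, Real.exp ((β + 1) * γ t)) / β ≤ stageLoss β τ p v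
      (∫ t in (0 : ℝ)..τ, Real.exp (-(β * (v + t * Real.exp (-v)))) * Real.exp (γ t)) := by
  have hi : ∀ {f : ℝ → ℝ}, Continuous f → IntervalIntegrable f volume 0 τ :=
    fun hf => hf.intervalIntegrable _ _
  rw [stageLoss, stagePower, ← intervalIntegral.integral_const_mul,
    ← intervalIntegral.integral_const_mul, ← intervalIntegral.integral_const_mul,
    ← intervalIntegral.integral_sub (hi (by fun_prop)) (hi (by fun_prop)),
    ← intervalIntegral.integral_neg, ← intervalIntegral.integral_div]
  refine intervalIntegral.integral_mono_on hτ.le (hi (by fun_prop)) (hi (by fun_prop)) fun t _ => ?_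
  refine (neg_exp_div_le hβ (-p - (v + t * Real.exp (-v))) (γ t)).trans_eq ?_
  rw [← Real.exp_add, ← Real.exp_add, ← Real.exp_add]
  congr 3 <;> ring

variable {Ω : Type*} [MeasurableSpace Ω] {P : Measure Ω} [IsProbabilityMeasure P]

lemma exp_neg_le_rpow {x s : ℝ} (hx : 0 < x) (hs : s ∈ Set.Icc 0 1) : Real.exp (-x) ≤ x ^ (-s) := by
  rw [Real.exp_neg, Real.rpow_neg hx.le]
  have h1 : x ^ s ≤ Real.exp x := by
    rcases le_total x 1 with h | h
    · exact (Real.rpow_le_one hx.le h hs.1).trans (Real.one_le_exp hx.le)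
    · calc x ^ s ≤ x ^ (1 : ℝ) := Real.rpow_le_rpow_of_exponent_le h hs.2
        _ = x := Real.rpow_one x
        _ ≤ Real.exp x := by linarith [Real.add_one_le_exp x]
  exact inv_anti₀ (Real.rpow_pos_of_pos hx s) h1

/-- Uniform lower bounds for the empirical loss of one stage: it is asymptotically at least the
population value at the truth, and asymptotically nonnegative for extreme scales. The observations
`(I, d)` consist of an indicator of failure in the stage and the time spent in the stage, and
failures have density `exp γ`. Failures at the very beginning of the stage are excluded: at `d = 0`
the bound of `exp (-x)` by `x ^ (-s)` fails, since `0 ^ (-s) = 0`. -/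
lemma ae_eventually_neg_le_stageLoss {Y : ℕ → Ω → ℝ × ℝ} {τ β : ℝ} (hτ : 0 < τ) (hβ : 0 < β)
    (hindep : iIndepFun Y P) (hident : ∀ i, IdentDistrib (Y i) (Y 0) P P)
    (hY : ∀ᵐ ω ∂P, ∀ i, Y i ω ∈ Set.Icc (0 : ℝ) 1 ×ˢ Set.Icc (0 : ℝ) τ)
    (hY0 : ∀ᵐ ω ∂P, ∀ i, (Y i ω).1 ≠ 0 → (Y i ω).2 ≠ 0)
    (hint : ∀ s : ℝ, s < 1 → Integrable (fun ω => (Y 0 ω).1 * (Y 0 ω).2 ^ (-s)) P)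
    {γ : ℝ → ℝ} (hγ : Continuous γ)
    (hlaw : ∀ h : ℝ → ℝ, Continuous h →
      ∫ ω, (Y 0 ω).1 * h (Y 0 ω).2 ∂P = ∫ t in (0 : ℝ)..τ, h t * Real.exp (γ t))
    {ε : ℝ} (hε : 0 < ε) :
    ∃ V : ℝ, ∀ᵐ ω ∂P, ∀ᶠ N in atTop, ∀ p v, 0 ≤ p →
      -(∫ t in (0 : ℝ)..τ, Real.exp ((β + 1) * γ t)) / β - ε ≤ stageLoss β τ p v
        (avg N fun i => (Y i ω).1 * Real.exp (-(β * (v + (Y i ω).2 * Real.exp (-v))))) ∧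
      (V ≤ |v| → -ε ≤ stageLoss β τ p v
        (avg N fun i => (Y i ω).1 * Real.exp (-(β * (v + (Y i ω).2 * Real.exp (-v)))))) := by
  -- the exponent lies in the interval `(β / (β + 1), 1)`
  set s : ℝ := (β + 1 / 2) / (β + 1) with hs
  have hs0 : 0 ≤ s := by positivity
  have hs1 : s < 1 := by
    rw [hs, div_lt_one (by positivity)]
    linarith
  have hsβ : β < s * (β + 1) := by
    rw [hs, div_mul_cancel₀ _ (by positivity)]
    linarith
  set m := ∫ ω, (Y 0 ω).1 * (Y 0 ω).2 ^ (-s) ∂P with hm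
  have hm0 : 0 ≤ m := by
    refine integral_nonneg_of_ae ?_
    filter_upwards [hY] with ω hω
    exact mul_nonneg (hω 0).1.1 (Real.rpow_nonneg (hω 0).2.1 _)
  set C := β ^ (-s) * (m + 1) with hC
  have hC0 : 0 < C := by positivity
  obtain ⟨V₁, hV₁⟩ := exists_neg_le_stageLoss hβ hτ hsβ hC0 hε
  have hlim : Tendsto (fun v => (β + 1) / β * Real.exp (-(β * v))) atTop (𝓝 0) := by
    have h1 : Tendsto (fun v : ℝ => β * v) atTop atTop := tendsto_id.const_mul_atTop hβ
    simpa using ((Real.tendsto_exp_neg_atTop_nhds_zero.comp h1).const_mul ((β + 1) / β))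
  obtain ⟨V₂, hV₂⟩ := eventually_atTop.1 (hlim.eventually_le_const hε)
  set V := max |V₁| |V₂| with hV
  set ε' := ε * β / (β + 1) with hε'
  have hε0 : 0 < ε' := by positivity
  have hulln := ae_eventually_forall_abs_avg_sub_lt (X := ℝ) hindep hident
    (isCompact_Icc.prod isCompact_Icc) hY
    (F := fun v y => y.1 * Real.exp (-(β * (v + y.2 * Real.exp (-v))))) (by fun_prop)
    (isCompact_Icc (a := -V) (b := V)) hε0
  have hlln : ∀ᵐ ω ∂P,
      Tendsto (fun N => avg N fun i => (Y i ω).1 * (Y i ω).2 ^ (-s)) atTop (𝓝 m) := by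
    have hmeas : Measurable fun y : ℝ × ℝ => y.1 * y.2 ^ (-s) := by fun_prop
    exact strong_law_ae (fun i ω => (Y i ω).1 * (Y i ω).2 ^ (-s)) (hint s hs1)
      (fun i j hij => (hindep.comp (fun _ => fun y : ℝ × ℝ => y.1 * y.2 ^ (-s))
        fun _ => hmeas).indepFun hij) (fun i => (hident i).comp hmeas)
  refine ⟨V, ?_⟩
  filter_upwards [hulln, hlln, hY, hY0] with ω hω₁ hω₂ hω₃ hω₄
  filter_upwards [hω₁, hω₂.eventually_le_const (lt_add_one m), eventually_ne_atTop 0]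
    with N hN₁ hN₂ hN₀ p v hp
  set B := avg N fun i => (Y i ω).1 * Real.exp (-(β * (v + (Y i ω).2 * Real.exp (-v)))) with hB
  -- for small `v` the mean of `d ^ (-s)` controls the density, for large `v` the density is small
  have htail : V ≤ |v| → -ε ≤ stageLoss β τ p v B := fun hVv => by
    rcases le_total v 0 with hv | hv
    · refine hV₁ p v B ?_ ?_
      · rw [abs_of_nonpos hv] at hVv
        linarith [neg_abs_le V₁, le_max_left |V₁| |V₂|]
      · have hle : ∀ i, (Y i ω).1 * Real.exp (-(β * (v + (Y i ω).2 * Real.exp (-v)))) ≤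
            β ^ (-s) * Real.exp ((s - β) * v) * ((Y i ω).1 * (Y i ω).2 ^ (-s)) := fun i => by
          rcases eq_or_ne (Y i ω).1 0 with h0 | h0
          · simp [h0]
          · have hd : 0 < (Y i ω).2 := lt_of_le_of_ne (hω₃ i).2.1 (hω₄ i h0).symm
            have h1 := exp_neg_le_rpow (x := β * (Y i ω).2 * Real.exp (-v)) (by positivity)
              ⟨hs0, hs1.le⟩
            rw [Real.mul_rpow (by positivity) (by positivity), Real.mul_rpow hβ.le hd.le,
              ← Real.exp_mul] at h1
            calc (Y i ω).1 * Real.exp (-(β * (v + (Y i ω).2 * Real.exp (-v))))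
                = (Y i ω).1 * (Real.exp (-(β * v)) *
                    Real.exp (-(β * (Y i ω).2 * Real.exp (-v)))) := by
                  rw [← Real.exp_add]
                  congr 2
                  ring
              _ ≤ (Y i ω).1 * (Real.exp (-(β * v)) *
                    (β ^ (-s) * (Y i ω).2 ^ (-s) * Real.exp (-v * -s))) := by
                  gcongr
                  exact (hω₃ i).1.1
              _ = _ := by
                  rw [show (s - β) * v = -(β * v) + -v * -s by ring, Real.exp_add]
                  ring
        refine (avg_mono hle).trans ?_
        rw [avg_mul_left, hC]
        calc _ ≤ β ^ (-s) * Real.exp ((s - β) * v) * (m + 1) := by gcongr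
          _ = _ := by ring
    · have hBle : B ≤ Real.exp (-(β * v)) := by
        rw [hB, ← avg_const hN₀ (Real.exp (-(β * v)))]
        refine avg_mono fun i => ?_
        have h1 := (hω₃ i).2.1
        calc _ ≤ 1 * Real.exp (-(β * v)) := by
              gcongr
              · exact (hω₃ i).1.2
              · have : 0 ≤ (Y i ω).2 * Real.exp (-v) := by positivity
                linarith
          _ = _ := one_mul _
      refine le_trans ?_ (stageLoss_anti hβ hBle)
      have h1 := stagePower_nonneg (β := β) hτ v
      have h2 : Real.exp (-(β * p)) ≤ 1 := Real.exp_le_one_iff.2 (by nlinarith)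
      have h3 : (β + 1) / β * Real.exp (-(β * v)) ≤ ε := by
        refine hV₂ v ?_
        rw [abs_of_nonneg hv] at hVv
        linarith [le_abs_self V₂, le_max_right |V₁| |V₂|]
      have h4 : (β + 1) / β * (Real.exp (-(β * p)) * Real.exp (-(β * v))) ≤
          (β + 1) / β * (1 * Real.exp (-(β * v))) := by gcongr
      have h5 : 0 ≤ Real.exp (-((β + 1) * p)) * stagePower β τ v := by positivity
      unfold stageLoss
      linarith
  refine ⟨?_, htail⟩
  have hJ : 0 ≤ (∫ t in (0 : ℝ)..τ, Real.exp ((β + 1) * γ t)) / β :=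
    div_nonneg (intervalIntegral.integral_nonneg hτ.le fun _ _ => (Real.exp_pos _).le) hβ.le
  rcases le_total V |v| with hv | hv
  · have := htail hv
    rw [neg_div]
    linarith
  · have h1 := (abs_lt.1 (hN₁ v (abs_le.1 hv))).2
    have h2 := hlaw (fun t => Real.exp (-(β * (v + t * Real.exp (-v))))) (by fun_prop)
    rw [h2] at h1
    have h3 := neg_integral_div_le_stageLoss hβ hτ hγ p v
    set B₀ := ∫ t in (0 : ℝ)..τ, Real.exp (-(β * (v + t * Real.exp (-v)))) * Real.exp (γ t) with hB₀
    have hBB : B ≤ B₀ + ε' := by linarith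
    refine le_trans ?_ (stageLoss_anti hβ hBB)
    have h4 : Real.exp (-(β * p)) ≤ 1 := Real.exp_le_one_iff.2 (by nlinarith)
    have h5 : (β + 1) / β * (Real.exp (-(β * p)) * ε') ≤ (β + 1) / β * (1 * ε') := by gcongr
    have h6 : (β + 1) / β * (1 * ε') = ε := by
      rw [hε']
      field_simp
    unfold stageLoss at h3 ⊢
    rw [mul_add, mul_add]
    linarith

end Stage

end SSALT

/-! ### Separation on compact sets -/

namespace SSALT

open MEstimation

variable {D : Design} {Ω : Type*} [MeasurableSpace Ω] {P : Measure Ω} {a : Param} {β : ℝ}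

section Population

variable {X : Ω → ℝ}

lemma integral_contrast (hτ₁ : 0 < D.τ₁) (hτ₂ : D.τ₁ < D.τ₂) (hX : HasLaw X (lifetimeLaw D a) P)
    (b : Param) :
    ∫ ω, contrast D β b (obs D (X ω)) ∂P =
      ∫ z, (Real.exp ((β + 1) * logDens D b z)
        - (β + 1) * (Real.exp (logDens D a z) * expQuotient β (logDens D b z)))
          ∂(refMeasure D) := by
  have ha := continuous_logDens_right D a
  have hb := continuous_logDens_right D b
  have hq := continuous_expQuotient β
  have hi : ∀ {f : Obs → ℝ}, Continuous f → Integrable f (refMeasure D) :=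
    fun hf => integrable_refMeasure hτ₁ hτ₂ hf
  rw [integral_comp_obs (f := fun z => contrast D β b z) hτ₁ hτ₂ hX (by unfold contrast; fun_prop),
    integral_sub (hi (by fun_prop)) (hi (by fun_prop)), ← meanPower, integral_const_mul]
  have hsplit : ∀ z, Real.exp (logDens D a z) • contrast D β b z =
      Real.exp (logDens D a z) * meanPower D β b
        - (β + 1) * (Real.exp (logDens D a z) * expQuotient β (logDens D b z)) := fun z => by
    rw [contrast, smul_eq_mul]
    ring
  simp only [hsplit]
  rw [integral_sub (hi (by fun_prop)) (hi (by fun_prop)), integral_mul_const,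
    integral_exp_logDens hτ₁ hτ₂, one_mul, integral_const_mul]

/-- Identifiability: the mean contrast is uniquely minimal at the true parameter. -/
lemma integral_contrast_lt (hx : D.x₁ < D.x₂) (hτ₁ : 0 < D.τ₁) (hτ₂ : D.τ₁ < D.τ₂)
    (hX : HasLaw X (lifetimeLaw D a) P) (hβ : 0 ≤ β) {b : Param} (hb : b ≠ a) :
    ∫ ω, contrast D β a (obs D (X ω)) ∂P < ∫ ω, contrast D β b (obs D (X ω)) ∂P := by
  have hca := continuous_logDens_right D a
  have hcb := continuous_logDens_right D b
  have hq := continuous_expQuotient β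
  rw [integral_contrast hτ₁ hτ₂ hX, integral_contrast hτ₁ hτ₂ hX, ← sub_pos,
    ← integral_sub (integrable_refMeasure hτ₁ hτ₂ (by fun_prop))
      (integrable_refMeasure hτ₁ hτ₂ (by fun_prop))]
  have hlt : ∀ z, logDens D b z ≠ logDens D a z → _ := fun z hz =>
    sub_pos.2 (contrast_lt_of_ne hβ hz)
  refine integral_refMeasure_pos D hτ₁ hτ₂ (by fun_prop) (fun z => ?_) ?_
  · rcases eq_or_ne (logDens D b z) (logDens D a z) with h | h
    · rw [h, sub_self]
    · exact (hlt z h).le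
  · by_contra! hcon
    have h1 : logDens D b (1, 0, 0, 0) = logDens D a (1, 0, 0, 0) := by
      by_contra h
      exact (hlt _ h).ne' hcon.1
    have h2 : logDens D b (0, 1, D.τ₁, 0) = logDens D a (0, 1, D.τ₁, 0) := by
      by_contra h
      exact (hlt _ h).ne' hcon.2
    have hu : logScale₁ D b = logScale₁ D a := by simpa [logDens] using h1
    have hv : logScale₂ D b = logScale₂ D a := by simpa [logDens, hu] using h2
    exact hb (sub_eq_zero.1 (eq_zero_of_logScale_eq_zero (s := b - a) hx (by simp [hu])
      (by simp [hv])))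

/-- Integrability of a function of a censored lifetime, possibly unbounded near the beginning of
a stage. -/
lemma integrable_comp_obs_of_integrableOn (hτ₁ : 0 < D.τ₁) (hτ₂ : D.τ₁ < D.τ₂) {X : Ω → ℝ}
    (hX : HasLaw X (lifetimeLaw D a) P) {f : Obs → ℝ} (hf : Measurable f)
    (h₁ : IntegrableOn (fun t => f (1, 0, t, 0)) (Set.Ioc 0 D.τ₁))
    (h₂ : IntegrableOn (fun t => f (0, 1, D.τ₁, t)) (Set.Ioc 0 (D.τ₂ - D.τ₁))) :
    Integrable (fun ω => f (obs D (X ω))) P := by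
  have hd := continuous_logDens_right D a
  have hmap : P.map (fun ω => obs D (X ω)) =
      (refMeasure D).withDensity fun z => ENNReal.ofReal (Real.exp (logDens D a z)) := by
    rw [← map_obs_lifetimeLaw D hτ₁ hτ₂, ← hX.map_eq,
      AEMeasurable.map_map_of_aemeasurable (measurable_obs D).aemeasurable hX.aemeasurable]
    rfl
  have hint : Integrable f (P.map fun ω => obs D (X ω)) := by
    rw [hmap, integrable_withDensity_iff_integrable_smul' hd.measurable.exp.ennreal_ofReal
      (Eventually.of_forall fun z => ENNReal.ofReal_lt_top)]
    simp only [ENNReal.toReal_ofReal (Real.exp_pos _).le, smul_eq_mul]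
    have hm : Measurable fun z => Real.exp (logDens D a z) * f z := hd.measurable.exp.mul hf
    rw [refMeasure, integrable_add_measure, integrable_add_measure,
      integrable_map_measure hm.aestronglyMeasurable (by fun_prop),
      integrable_map_measure hm.aestronglyMeasurable (by fun_prop)]
    refine ⟨⟨?_, ?_⟩, integrable_dirac enorm_lt_top⟩
    · rw [← IntegrableOn, ← integrableOn_Icc_iff_integrableOn_Ioc] at *
      exact h₁.continuousOn_mul (g := fun t => Real.exp (logDens D a (1, 0, t, 0)))
        (by fun_prop) isCompact_Icc
    · rw [← IntegrableOn, ← integrableOn_Icc_iff_integrableOn_Ioc] at *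
      exact h₂.continuousOn_mul (g := fun t => Real.exp (logDens D a (0, 1, D.τ₁, t)))
        (by fun_prop) isCompact_Icc
  exact hint.comp_aemeasurable ((measurable_obs D).comp_aemeasurable hX.aemeasurable)

end Population

section Sample

variable {T : ℕ → Ω → ℝ}

lemma iIndepFun_obs (hindep : iIndepFun T P) : iIndepFun (fun i ω => obs D (T i ω)) P :=
  hindep.comp (fun _ => obs D) fun _ => measurable_obs D

lemma identDistrib_obs (hT : ∀ i, HasLaw (T i) (lifetimeLaw D a) P) (i : ℕ) :
    IdentDistrib (fun ω => obs D (T i ω)) (fun ω => obs D (T 0 ω)) P P :=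
  IdentDistrib.comp ⟨(hT i).aemeasurable, (hT 0).aemeasurable, by
    rw [(hT i).map_eq, (hT 0).map_eq]⟩ (measurable_obs D)

lemma ae_forall_obs_mem (hτ₁ : 0 < D.τ₁) (hτ₂ : D.τ₁ < D.τ₂)
    (hT : ∀ i, HasLaw (T i) (lifetimeLaw D a) P) : ∀ᵐ ω ∂P, ∀ i, obs D (T i ω) ∈ obsRange D :=
  ae_all_iff.2 fun i => ae_obs_mem hτ₁ hτ₂ (hT i)

variable [IsProbabilityMeasure P]

/-- Separation of the true parameter from a compact set of parameters. -/
lemma ae_separation_of_isCompact (hx : D.x₁ < D.x₂) (hτ₁ : 0 < D.τ₁) (hτ₂ : D.τ₁ < D.τ₂)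
    (hβ : 0 ≤ β) (hT : ∀ i, HasLaw (T i) (lifetimeLaw D a) P) (hindep : iIndepFun T P)
    {C : Set Param} (hC : IsCompact C) (haC : a ∉ C) :
    ∀ᵐ ω ∂P, ∀ᶠ N in atTop, ∀ b ∈ C,
      (avg N fun i => contrast D β a (obs D (T i ω))) <
        avg N fun i => contrast D β b (obs D (T i ω)) := by
  set M : Param → ℝ := fun b => ∫ ω, contrast D β b (obs D (T 0 ω)) ∂P with hM
  have hMc : Continuous M := by
    have hc := continuous_contrast hτ₁ hτ₂ β
    have h := continuous_integral_of_isCompact (μ := P.map fun ω => obs D (T 0 ω)) hc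
      (isCompact_obsRange D) ?_
    · refine h.congr fun b => ?_
      have := (measurable_obs D).comp_aemeasurable (hT 0).aemeasurable
      exact integral_map this
        (hc.comp (continuous_const.prodMk continuous_id)).aestronglyMeasurable
    · exact (ae_map_iff ((measurable_obs D).comp_aemeasurable (hT 0).aemeasurable)
        (isCompact_obsRange D).measurableSet).2 (ae_obs_mem hτ₁ hτ₂ (hT 0))
  rcases C.eq_empty_or_nonempty with rfl | hne
  · simp
  obtain ⟨b₀, hb₀, hmin⟩ := hC.exists_isMinOn hne hMc.continuousOn
  have hlt : M a < M b₀ := integral_contrast_lt hx hτ₁ hτ₂ (hT 0) hβ fun h => haC (h ▸ hb₀)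
  have hulln := ae_eventually_forall_abs_avg_sub_lt (iIndepFun_obs hindep) (identDistrib_obs hT)
    (isCompact_obsRange D) (ae_forall_obs_mem hτ₁ hτ₂ hT) (continuous_contrast hτ₁ hτ₂ β)
    (hC.insert a) (half_pos (sub_pos.2 hlt))
  filter_upwards [hulln] with ω hω
  filter_upwards [hω] with N hN b hb
  have h1 := (abs_lt.1 (hN a (Set.mem_insert a C))).2
  have h2 := (abs_lt.1 (hN b (Set.mem_insert_of_mem a hb))).1
  have h3 : M b₀ ≤ M b := hmin hb
  simp only [hM] at h3 hlt h1 h2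
  linarith

/-- For maximum likelihood the contrast is convex in the parameter. -/
lemma convexOn_contrast_zero (hτ₁ : 0 < D.τ₁) (hτ₂ : D.τ₁ < D.τ₂) {z : Obs} (hz : z ∈ obsRange D) :
    ConvexOn ℝ Set.univ fun b => contrast D 0 b z := by
  have hexp : ∀ A : Param →L[ℝ] ℝ, ConvexOn ℝ Set.univ fun b => Real.exp (-A b) := fun A =>
    convexOn_exp.comp_linearMap (-A : Param →L[ℝ] ℝ).toLinearMap
  have hlin : ConvexOn ℝ Set.univ fun b => (z.1 • logScale₁ D + z.2.1 • logScale₂ D) b :=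
    (z.1 • logScale₁ D + z.2.1 • logScale₂ D).toLinearMap.convexOn convex_univ
  have h := (((hlin.add ((hexp (logScale₁ D)).smul hz.2.2.1.1)).add
    ((hexp (logScale₂ D)).smul hz.2.2.2.1))).add_const 1
  refine h.congr fun b _ => ?_
  rw [contrast, meanPower_zero hτ₁ hτ₂, expQuotient, if_pos rfl, logDens]
  simp
  ring

lemma ae_separation_zero (hx : D.x₁ < D.x₂) (hτ₁ : 0 < D.τ₁) (hτ₂ : D.τ₁ < D.τ₂)
    (hT : ∀ i, HasLaw (T i) (lifetimeLaw D a) P) (hindep : iIndepFun T P) {ε : ℝ} (hε : 0 < ε) :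
    ∀ᵐ ω ∂P, ∀ᶠ N in atTop, ∀ b, ε ≤ ‖b - a‖ →
      (avg N fun i => contrast D 0 a (obs D (T i ω))) <
        avg N fun i => contrast D 0 b (obs D (T i ω)) := by
  have hsphere := ae_separation_of_isCompact hx hτ₁ hτ₂ le_rfl hT hindep (isCompact_sphere a ε)
    (by simpa using hε.ne)
  filter_upwards [hsphere, ae_forall_obs_mem hτ₁ hτ₂ hT] with ω hω hobs
  filter_upwards [hω] with N hN b hb
  set F : Param → ℝ := fun b => avg N fun i => contrast D 0 b (obs D (T i ω)) with hF
  have hconv : ConvexOn ℝ Set.univ F := by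
    have hsum : ∀ s : Finset ℕ, ConvexOn ℝ Set.univ
        fun b => ∑ i ∈ s, contrast D 0 b (obs D (T i ω)) := fun s => by
      induction s using Finset.induction_on with
      | empty => simpa using convexOn_const (0 : ℝ) convex_univ
      | insert i s his ih =>
        simp only [Finset.sum_insert his]
        exact (convexOn_contrast_zero hτ₁ hτ₂ (hobs i)).add ih
    exact (hsum (Finset.range N)).smul (inv_nonneg.2 N.cast_nonneg)
  have hba : 0 < ‖b - a‖ := hε.trans_le hb
  -- compare with the point of the sphere on the segment from `a` to `b`
  set r := ε / ‖b - a‖ with hr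
  have hr0 : 0 < r := div_pos hε hba
  have hr1 : r ≤ 1 := (div_le_one hba).2 hb
  have hmem : (1 - r) • a + r • b ∈ Metric.sphere a ε := by
    rw [mem_sphere_iff_norm, show (1 - r) • a + r • b - a = r • (b - a) by module, norm_smul,
      Real.norm_of_nonneg hr0.le, hr, div_mul_cancel₀ _ hba.ne']
  have h1 : F a < F ((1 - r) • a + r • b) := hN _ hmem
  have h2 := hconv.2 (Set.mem_univ a) (Set.mem_univ b) (sub_nonneg.2 hr1) hr0.le (by ring)
  simp only [smul_eq_mul] at h2
  change F a < F b
  nlinarith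

end Sample

end SSALT

/-! ### Separation away from compact sets -/

namespace SSALT

open MEstimation

variable {D : Design} {Ω : Type*} [MeasurableSpace Ω] {P : Measure Ω} {a : Param} {β : ℝ}

lemma integrableOn_rpow_neg {τ s : ℝ} (hτ : 0 < τ) (hs : s < 1) :
    IntegrableOn (fun t : ℝ => t ^ (-s)) (Set.Ioc 0 τ) :=
  (intervalIntegrable_iff_integrableOn_Ioc_of_le hτ.le).1
    (intervalIntegral.intervalIntegrable_rpow' (by linarith))

/-- The average of the `β`-th power of the exponential density with log-scale `u`, over the units
that fail under the first stress; the other units contribute `0`. -/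
def firstMean (β : ℝ) (N : ℕ) (z : ℕ → Obs) (u : ℝ) : ℝ :=
  avg N fun i => (z i).1 * Real.exp (-(β * (u + (z i).2.2.1 * Real.exp (-u))))

/-- The average of the `β`-th power of the exponential density with log-scale `v`, evaluated at the
time since the change of stress, over the units that fail under the second stress; the other units
contribute `0`. -/
def secondMean (β : ℝ) (N : ℕ) (z : ℕ → Obs) (v : ℝ) : ℝ :=
  avg N fun i => (z i).2.1 * Real.exp (-(β * (v + (z i).2.2.2 * Real.exp (-v))))

/-- The frequency of survivors. -/
def survivalFreq (N : ℕ) (z : ℕ → Obs) : ℝ := avg N fun i => 1 - (z i).1 - (z i).2.1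

lemma exp_mul_logDens_obs (b : Param) (t : ℝ) :
    Real.exp (β * logDens D b (obs D t)) =
      (obs D t).1 * Real.exp (-(β * (logScale₁ D b + (obs D t).2.2.1 * Real.exp (-logScale₁ D b))))
      + Real.exp (-(β * (D.τ₁ * Real.exp (-logScale₁ D b)))) *
        ((obs D t).2.1 *
          Real.exp (-(β * (logScale₂ D b + (obs D t).2.2.2 * Real.exp (-logScale₂ D b)))))
      + Real.exp (-(β * (D.τ₁ * Real.exp (-logScale₁ D b)
          + (D.τ₂ - D.τ₁) * Real.exp (-logScale₂ D b)))) * (1 - (obs D t).1 - (obs D t).2.1) := by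
  unfold obs logDens
  split_ifs with h1 h2
  · simp
    ring
  · simp only [zero_mul, zero_add, one_mul, sub_zero, sub_self, mul_zero, add_zero]
    rw [← Real.exp_add]
    congr 1
    ring
  · simp only [zero_mul, zero_add, sub_zero, mul_zero, mul_one]
    congr 1
    ring

lemma meanPower_eq_stagePower (hτ₁ : 0 < D.τ₁) (hτ₂ : D.τ₁ < D.τ₂) (b : Param) :
    meanPower D β b = stagePower β D.τ₁ (logScale₁ D b)
      + Real.exp (-((β + 1) * (D.τ₁ * Real.exp (-logScale₁ D b)))) *
          stagePower β (D.τ₂ - D.τ₁) (logScale₂ D b)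
      + Real.exp (-((β + 1) * (D.τ₁ * Real.exp (-logScale₁ D b)
          + (D.τ₂ - D.τ₁) * Real.exp (-logScale₂ D b)))) := by
  have hd := continuous_logDens_right D b
  rw [meanPower, integral_refMeasure D hτ₁ hτ₂ (by fun_prop), stagePower, stagePower,
    ← intervalIntegral.integral_const_mul]
  congr 1
  · congr 1
    · refine intervalIntegral.integral_congr fun t _ => ?_
      simp only [logDens]
      congr 1
      ring
    · refine intervalIntegral.integral_congr fun t _ => ?_
      simp only [logDens]
      rw [← Real.exp_add]
      congr 1
      ring
  · rw [logDens]
    congr 1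
    ring

/-- The average contrast splits into the contributions of the two stages and of the survivors. -/
lemma avg_contrast_eq (hτ₁ : 0 < D.τ₁) (hτ₂ : D.τ₁ < D.τ₂) (hβ : 0 < β) {N : ℕ} (hN : N ≠ 0)
    (t : ℕ → ℝ) (b : Param) :
    (avg N fun i => contrast D β b (obs D (t i))) =
      stageLoss β D.τ₁ 0 (logScale₁ D b)
        (firstMean β N (fun i => obs D (t i)) (logScale₁ D b))
      + stageLoss β (D.τ₂ - D.τ₁) (D.τ₁ * Real.exp (-logScale₁ D b)) (logScale₂ D b)
        (secondMean β N (fun i => obs D (t i)) (logScale₂ D b))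
      + (Real.exp (-((β + 1) * (D.τ₁ * Real.exp (-logScale₁ D b)
          + (D.τ₂ - D.τ₁) * Real.exp (-logScale₂ D b))))
        - (β + 1) / β * (Real.exp (-(β * (D.τ₁ * Real.exp (-logScale₁ D b)
          + (D.τ₂ - D.τ₁) * Real.exp (-logScale₂ D b)))) *
            survivalFreq N fun i => obs D (t i)))
      + (β + 1) / β := by
  have hc : ∀ i, contrast D β b (obs D (t i)) = (meanPower D β b + (β + 1) / β)
      - (β + 1) / β * Real.exp (β * logDens D b (obs D (t i))) := fun i => by
    rw [contrast, expQuotient, if_neg hβ.ne']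
    field_simp
    ring
  simp only [hc]
  rw [avg_sub, avg_const hN, avg_mul_left]
  simp only [exp_mul_logDens_obs]
  rw [avg_add, avg_add, avg_mul_left, avg_mul_left, meanPower_eq_stagePower hτ₁ hτ₂, stageLoss,
    stageLoss, firstMean, secondMean, survivalFreq]
  simp only [mul_zero, neg_zero, Real.exp_zero, one_mul]
  ring

/-- At the true parameter the mean contrast is an affine function of the mean power. -/
lemma integral_contrast_self (hτ₁ : 0 < D.τ₁) (hτ₂ : D.τ₁ < D.τ₂) (hβ : 0 < β) {X : Ω → ℝ}
    (hX : HasLaw X (lifetimeLaw D a) P) :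
    ∫ ω, contrast D β a (obs D (X ω)) ∂P = -meanPower D β a / β + (β + 1) / β := by
  have hd := continuous_logDens_right D a
  have hz : ∀ z, Real.exp ((β + 1) * logDens D a z)
      - (β + 1) * (Real.exp (logDens D a z) * expQuotient β (logDens D a z)) =
      -(1 / β) * Real.exp ((β + 1) * logDens D a z)
        + (β + 1) / β * Real.exp (logDens D a z) := fun z => by
    rw [expQuotient, if_neg hβ.ne', show (β + 1) * logDens D a z =
      logDens D a z + β * logDens D a z by ring, Real.exp_add]
    field_simp
    ring
  rw [integral_contrast hτ₁ hτ₂ hX]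
  simp only [hz]
  rw [integral_add (integrable_refMeasure hτ₁ hτ₂ (by fun_prop))
      (integrable_refMeasure hτ₁ hτ₂ (by fun_prop)), integral_const_mul,
    integral_const_mul, integral_exp_logDens hτ₁ hτ₂, meanPower]
  ring

/-- The survivors contribute at least the population value, up to an error. -/
lemma neg_exp_div_sub_le {y π F ε : ℝ} (hβ : 0 < β) (hε : 0 < ε) (hy : 0 ≤ y)
    (hF : F ≤ Real.exp π + ε * β / (β + 1)) :
    -(Real.exp ((β + 1) * π) / β) - ε ≤
      Real.exp (-((β + 1) * y)) - (β + 1) / β * (Real.exp (-(β * y)) * F) := by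
  have hyoung := neg_exp_div_le hβ (-y) π
  rw [Real.exp_add, mul_neg, mul_neg, neg_div] at hyoung
  have h4 : Real.exp (-(β * y)) ≤ 1 := Real.exp_le_one_iff.2 (by nlinarith)
  have h5 : (β + 1) / β * (Real.exp (-(β * y)) * F) ≤
      (β + 1) / β * (Real.exp (-(β * y)) * Real.exp π + 1 * (ε * β / (β + 1))) := by
    gcongr
    calc Real.exp (-(β * y)) * F ≤ Real.exp (-(β * y)) * (Real.exp π + ε * β / (β + 1)) := by gcongr
      _ ≤ _ := by
        rw [mul_add]
        gcongr
  have h6 : (β + 1) / β * (1 * (ε * β / (β + 1))) = ε := by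
    field_simp
  rw [mul_add, h6] at h5
  linarith

/-- The parameters whose two log-scales are bounded by `V` form a bounded set. -/
lemma exists_isCompact_of_abs_logScale_le (hx : D.x₁ < D.x₂) (V : ℝ) :
    ∃ C : Set Param, IsCompact C ∧ ∀ b, |logScale₁ D b| ≤ V → |logScale₂ D b| ≤ V → b ∈ C := by
  set G : ℝ × ℝ → Param := fun w =>
    !₂[w.1 - (w.2 - w.1) / (D.x₂ - D.x₁) * D.x₁, (w.2 - w.1) / (D.x₂ - D.x₁)] with hG
  have hGc : Continuous G := by fun_prop
  refine ⟨G '' (Set.Icc (-V) V ×ˢ Set.Icc (-V) V), (isCompact_Icc.prod isCompact_Icc).image hGc,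
    fun b hu hv => ⟨(logScale₁ D b, logScale₂ D b), ⟨abs_le.1 hu, abs_le.1 hv⟩, ?_⟩⟩
  have hx' : D.x₂ - D.x₁ ≠ 0 := (sub_pos.2 hx).ne'
  rw [hG, ← sub_eq_zero]
  refine eq_zero_of_logScale_eq_zero hx ?_ ?_
  · rw [map_sub, logScale₁_apply D !₂[_, _]]
    simp
  · rw [map_sub, logScale₂_apply D !₂[_, _]]
    simp
    field_simp
    ring

lemma ae_forall_ne {T : ℕ → Ω → ℝ} (hT : ∀ i, HasLaw (T i) (lifetimeLaw D a) P) (r : ℝ) :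
    ∀ᵐ ω ∂P, ∀ i, T i ω ≠ r :=
  ae_all_iff.2 fun i => ae_of_ae_map (hT i).aemeasurable (by
    rw [(hT i).map_eq]
    exact ae_ne_lifetimeLaw a r)

section Sample

variable [IsProbabilityMeasure P] {T : ℕ → Ω → ℝ}

lemma exists_neg_le_stageLoss_firstMean (hτ₁ : 0 < D.τ₁) (hτ₂ : D.τ₁ < D.τ₂)
    (hβ : 0 < β) (hT : ∀ i, HasLaw (T i) (lifetimeLaw D a) P) (hindep : iIndepFun T P) {ε : ℝ}
    (hε : 0 < ε) :
    ∃ V : ℝ, ∀ᵐ ω ∂P, ∀ᶠ N in atTop, ∀ p u, 0 ≤ p →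
      -(∫ t in (0 : ℝ)..D.τ₁, Real.exp ((β + 1) * logDens D a (1, 0, t, 0))) / β - ε ≤
        stageLoss β D.τ₁ p u (firstMean β N (fun i => obs D (T i ω)) u) ∧
      (V ≤ |u| → -ε ≤ stageLoss β D.τ₁ p u (firstMean β N (fun i => obs D (T i ω)) u)) := by
  have hobs := ae_forall_obs_mem hτ₁ hτ₂ hT
  have hd := continuous_logDens_right D a
  have hp : Measurable fun z : Obs => (z.1, z.2.2.1) := by fun_prop
  refine ae_eventually_neg_le_stageLoss (P := P)
    (Y := fun i ω => ((obs D (T i ω)).1, (obs D (T i ω)).2.2.1)) hτ₁ hβ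
    ((iIndepFun_obs hindep).comp (fun _ z => (z.1, z.2.2.1)) fun _ => hp)
    (fun i => (identDistrib_obs hT i).comp hp)
    (hobs.mono fun ω hω i => ⟨(hω i).1, (hω i).2.2.1⟩) ?_ ?_
    (γ := fun t => logDens D a (1, 0, t, 0)) (by fun_prop) ?_ hε
  · filter_upwards [ae_forall_ne hT 0] with ω hω i
    have := hω i
    unfold obs
    split_ifs <;> simp [this]
  · exact fun s hs => integrable_comp_obs_of_integrableOn (f := fun z => z.1 * z.2.2.1 ^ (-s))
      hτ₁ hτ₂ (hT 0) (by fun_prop) (by simpa using integrableOn_rpow_neg hτ₁ hs) (by simp)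
  · intro h hh
    rw [integral_comp_obs (f := fun z => z.1 * h z.2.2.1) hτ₁ hτ₂ (hT 0) (by fun_prop),
      integral_refMeasure D hτ₁ hτ₂ (by fun_prop)]
    simp [mul_comm]

lemma exists_neg_le_stageLoss_secondMean (hτ₁ : 0 < D.τ₁) (hτ₂ : D.τ₁ < D.τ₂)
    (hβ : 0 < β) (hT : ∀ i, HasLaw (T i) (lifetimeLaw D a) P) (hindep : iIndepFun T P) {ε : ℝ}
    (hε : 0 < ε) :
    ∃ V : ℝ, ∀ᵐ ω ∂P, ∀ᶠ N in atTop, ∀ p v, 0 ≤ p →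
      -(∫ t in (0 : ℝ)..(D.τ₂ - D.τ₁), Real.exp ((β + 1) * logDens D a (0, 1, D.τ₁, t))) / β - ε ≤
        stageLoss β (D.τ₂ - D.τ₁) p v (secondMean β N (fun i => obs D (T i ω)) v) ∧
      (V ≤ |v| → -ε ≤
        stageLoss β (D.τ₂ - D.τ₁) p v (secondMean β N (fun i => obs D (T i ω)) v)) := by
  have hΔ : 0 < D.τ₂ - D.τ₁ := sub_pos.2 hτ₂
  have hobs := ae_forall_obs_mem hτ₁ hτ₂ hT
  have hd := continuous_logDens_right D a
  have hp : Measurable fun z : Obs => (z.2.1, z.2.2.2) := by fun_prop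
  refine ae_eventually_neg_le_stageLoss (P := P)
    (Y := fun i ω => ((obs D (T i ω)).2.1, (obs D (T i ω)).2.2.2)) hΔ hβ
    ((iIndepFun_obs hindep).comp (fun _ z => (z.2.1, z.2.2.2)) fun _ => hp)
    (fun i => (identDistrib_obs hT i).comp hp)
    (hobs.mono fun ω hω i => ⟨(hω i).2.1, (hω i).2.2.2⟩) ?_ ?_
    (γ := fun t => logDens D a (0, 1, D.τ₁, t)) (by fun_prop) ?_ hε
  · filter_upwards [ae_forall_ne hT D.τ₁] with ω hω i
    have := sub_ne_zero.2 (hω i)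
    unfold obs
    split_ifs <;> simp [this]
  · exact fun s hs => integrable_comp_obs_of_integrableOn (f := fun z => z.2.1 * z.2.2.2 ^ (-s))
      hτ₁ hτ₂ (hT 0) (by fun_prop) (by simp) (by simpa using integrableOn_rpow_neg hΔ hs)
  · intro h hh
    rw [integral_comp_obs (f := fun z => z.2.1 * h z.2.2.2) hτ₁ hτ₂ (hT 0) (by fun_prop),
      integral_refMeasure D hτ₁ hτ₂ (by fun_prop)]
    simp [mul_comm]

lemma ae_tendsto_survivalFreq (hτ₁ : 0 < D.τ₁) (hτ₂ : D.τ₁ < D.τ₂)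
    (hT : ∀ i, HasLaw (T i) (lifetimeLaw D a) P) (hindep : iIndepFun T P) :
    ∀ᵐ ω ∂P, Tendsto (fun N => survivalFreq N fun i => obs D (T i ω)) atTop
      (𝓝 (Real.exp (logDens D a (0, 0, D.τ₁, D.τ₂ - D.τ₁)))) := by
  have hd := continuous_logDens_right D a
  have h := ae_tendsto_avg (iIndepFun_obs hindep) (identDistrib_obs hT) (isCompact_obsRange D)
    (ae_forall_obs_mem hτ₁ hτ₂ hT) (f := fun z : Obs => 1 - z.1 - z.2.1) (by fun_prop)
  have he : ∫ ω, 1 - (obs D (T 0 ω)).1 - (obs D (T 0 ω)).2.1 ∂P =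
      Real.exp (logDens D a (0, 0, D.τ₁, D.τ₂ - D.τ₁)) := by
    rw [integral_comp_obs (f := fun z => 1 - z.1 - z.2.1) hτ₁ hτ₂ (hT 0) (by fun_prop),
      integral_refMeasure D hτ₁ hτ₂ (by fun_prop)]
    simp
  rwa [he] at h

lemma ae_tendsto_avg_contrast_self (hτ₁ : 0 < D.τ₁) (hτ₂ : D.τ₁ < D.τ₂) (hβ : 0 < β)
    (hT : ∀ i, HasLaw (T i) (lifetimeLaw D a) P) (hindep : iIndepFun T P) :
    ∀ᵐ ω ∂P, Tendsto (fun N => avg N fun i => contrast D β a (obs D (T i ω))) atTop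
      (𝓝 (-meanPower D β a / β + (β + 1) / β)) := by
  have hd := continuous_logDens_right D a
  have hq := continuous_expQuotient β
  have hc : Continuous fun z => contrast D β a z := by
    unfold contrast
    fun_prop
  rw [← integral_contrast_self hτ₁ hτ₂ hβ (hT 0)]
  exact ae_tendsto_avg (iIndepFun_obs hindep) (identDistrib_obs hT) (isCompact_obsRange D)
    (ae_forall_obs_mem hτ₁ hτ₂ hT) hc

/-- For `β > 0` only parameters in a compact set can compete with the true parameter. -/
lemma exists_ae_separation_of_notMem (hx : D.x₁ < D.x₂) (hτ₁ : 0 < D.τ₁) (hτ₂ : D.τ₁ < D.τ₂)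
    (hβ : 0 < β) (hT : ∀ i, HasLaw (T i) (lifetimeLaw D a) P) (hindep : iIndepFun T P) :
    ∃ C : Set Param, IsCompact C ∧ ∀ᵐ ω ∂P, ∀ᶠ N in atTop, ∀ b ∉ C,
      (avg N fun i => contrast D β a (obs D (T i ω))) <
        avg N fun i => contrast D β b (obs D (T i ω)) := by
  have hΔ : 0 < D.τ₂ - D.τ₁ := sub_pos.2 hτ₂
  have hd := continuous_logDens_right D a
  set π := logDens D a (0, 0, D.τ₁, D.τ₂ - D.τ₁) with hπ
  set J₁ := ∫ t in (0 : ℝ)..D.τ₁, Real.exp ((β + 1) * logDens D a (1, 0, t, 0)) with hJ₁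
  set J₂ := ∫ t in (0 : ℝ)..(D.τ₂ - D.τ₁), Real.exp ((β + 1) * logDens D a (0, 1, D.τ₁, t)) with hJ₂
  have hJ₁0 : 0 < J₁ := intervalIntegral.integral_pos hτ₁ (by fun_prop)
    (fun t _ => (Real.exp_pos _).le) ⟨0, ⟨le_rfl, hτ₁.le⟩, Real.exp_pos _⟩
  have hJ₂0 : 0 < J₂ := intervalIntegral.integral_pos hΔ (by fun_prop)
    (fun t _ => (Real.exp_pos _).le) ⟨0, ⟨le_rfl, hΔ.le⟩, Real.exp_pos _⟩
  have hmean : meanPower D β a = J₁ + J₂ + Real.exp ((β + 1) * π) := by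
    rw [meanPower, integral_refMeasure D hτ₁ hτ₂ (by fun_prop)]
  -- the excess loss of at least `min J₁ J₂ / β` outweighs four error terms of size `ε`
  set ε := min J₁ J₂ / (5 * β) with hε
  have hε0 : 0 < ε := div_pos (lt_min hJ₁0 hJ₂0) (by positivity)
  have hmin₁ : 5 * ε ≤ J₁ / β := by
    rw [hε, le_div_iff₀ hβ]
    field_simp
    exact min_le_left _ _
  have hmin₂ : 5 * ε ≤ J₂ / β := by
    rw [hε, le_div_iff₀ hβ]
    field_simp
    exact min_le_right _ _
  obtain ⟨V₁, hV₁⟩ := exists_neg_le_stageLoss_firstMean hτ₁ hτ₂ hβ hT hindep hε0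
  obtain ⟨V₂, hV₂⟩ := exists_neg_le_stageLoss_secondMean hτ₁ hτ₂ hβ hT hindep hε0
  obtain ⟨C, hC, hmem⟩ := exists_isCompact_of_abs_logScale_le hx (max V₁ V₂)
  refine ⟨C, hC, ?_⟩
  filter_upwards [hV₁, hV₂, ae_tendsto_survivalFreq hτ₁ hτ₂ hT hindep,
    ae_tendsto_avg_contrast_self hτ₁ hτ₂ hβ hT hindep] with ω hω₁ hω₂ hω₃ hω₄
  have hε'0 : 0 < ε * β / (β + 1) := by positivity
  filter_upwards [hω₁, hω₂, hω₃.eventually_le_const (lt_add_of_pos_right _ hε'0),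
    hω₄.eventually_lt_const (lt_add_of_pos_right _ hε0), eventually_ne_atTop 0]
    with N h₁ h₂ h₃ h₄ hN b hb
  refine h₄.trans_le ?_
  rw [avg_contrast_eq hτ₁ hτ₂ hβ hN, hmean]
  obtain ⟨h₁a, h₁b⟩ := h₁ 0 (logScale₁ D b) le_rfl
  obtain ⟨h₂a, h₂b⟩ := h₂ (D.τ₁ * Real.exp (-logScale₁ D b)) (logScale₂ D b) (by positivity)
  have hthird := neg_exp_div_sub_le (y := D.τ₁ * Real.exp (-logScale₁ D b)
    + (D.τ₂ - D.τ₁) * Real.exp (-logScale₂ D b)) hβ hε0 (by positivity) h₃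
  have hfar : V₁ ≤ |logScale₁ D b| ∨ V₂ ≤ |logScale₂ D b| := by
    by_contra! hcon
    exact hb (hmem b (hcon.1.le.trans (le_max_left _ _)) (hcon.2.le.trans (le_max_right _ _)))
  rw [neg_div] at h₁a h₂a
  rw [neg_div, add_div, add_div]
  rcases hfar with h | h
  · linarith [h₁b h]
  · linarith [h₂b h]

/-- Almost surely, for large samples, the average contrast at parameters away from the true one
exceeds its value at the true parameter. -/
theorem ae_separation (hx : D.x₁ < D.x₂) (hτ₁ : 0 < D.τ₁) (hτ₂ : D.τ₁ < D.τ₂) (hβ : 0 ≤ β)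
    (hT : ∀ i, HasLaw (T i) (lifetimeLaw D a) P) (hindep : iIndepFun T P) :
    ∀ᵐ ω ∂P, ∀ ε > 0, ∀ᶠ N in atTop, ∀ b, ε ≤ ‖b - a‖ →
      (avg N fun i => contrast D β a (obs D (T i ω))) <
        avg N fun i => contrast D β b (obs D (T i ω)) := by
  have hfix : ∀ ε > 0, ∀ᵐ ω ∂P, ∀ᶠ N in atTop, ∀ b, ε ≤ ‖b - a‖ →
      (avg N fun i => contrast D β a (obs D (T i ω))) <
        avg N fun i => contrast D β b (obs D (T i ω)) := fun ε hε => by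
    rcases hβ.eq_or_lt with rfl | hβ'
    · exact ae_separation_zero hx hτ₁ hτ₂ hT hindep hε
    · obtain ⟨C, hC, hfar⟩ := exists_ae_separation_of_notMem hx hτ₁ hτ₂ hβ' hT hindep
      have hclosed : IsClosed {b : Param | ε ≤ ‖b - a‖} :=
        isClosed_le continuous_const (by fun_prop)
      have hnear := ae_separation_of_isCompact hx hτ₁ hτ₂ hβ hT hindep (hC.inter_right hclosed)
        (fun h => by simpa using hε.trans_le h.2)
      filter_upwards [hfar, hnear] with ω h₁ h₂
      filter_upwards [h₁, h₂] with N h₃ h₄ b hb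
      by_cases hbC : b ∈ C
      · exact h₄ b ⟨hbC, hb⟩
      · exact h₃ b hbC
  have hall : ∀ᵐ ω ∂P, ∀ n : ℕ, ∀ᶠ N in atTop, ∀ b, 1 / ((n : ℝ) + 1) ≤ ‖b - a‖ →
      (avg N fun i => contrast D β a (obs D (T i ω))) <
        avg N fun i => contrast D β b (obs D (T i ω)) :=
    ae_all_iff.2 fun n => hfix _ (by positivity)
  filter_upwards [hall] with ω hω ε hε
  obtain ⟨n, hn⟩ := exists_nat_one_div_lt hε
  filter_upwards [hω n] with N hN b hb using hN b (hn.le.trans hb)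

end Sample

end SSALT

/-! ### The loss and its minimizers -/

namespace SSALT

open MEstimation Matrix

section Loss

variable (D : Design)

/-- In each of the three cases the likelihood contribution of a unit is `exp logDens`. -/
lemma sum_failed_add_survivors (N : ℕ) (t : ℕ → ℝ) (a : Param) (g : ℝ → ℝ) :
    (∑ i ∈ failed₁ D N t, g (f₁ D a (t i))) + (∑ i ∈ failed₂ D N t, g (f₂ D a (t i)))
        + survivors D N t * g (1 - F₂ D a D.τ₂) =
      ∑ i ∈ Finset.range N, g (Real.exp (logDens D a (obs D (t i)))) := by
  have hN : (N : ℝ) = ∑ i ∈ Finset.range N, (1 : ℝ) := by simp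
  rw [survivors, hN, failed₁, failed₂, Finset.card_filter, Finset.card_filter, Finset.sum_filter,
    Finset.sum_filter, Nat.cast_sum, Nat.cast_sum, ← Finset.sum_sub_distrib,
    ← Finset.sum_sub_distrib, Finset.sum_mul, ← Finset.sum_add_distrib, ← Finset.sum_add_distrib]
  refine Finset.sum_congr rfl fun i _ => ?_
  rw [one_sub_F₂_eq, f₁_eq, f₂_eq, obs]
  by_cases h1 : t i < D.τ₁
  · simp [h1, not_le.2 h1]
  · by_cases h2 : t i < D.τ₂
    · simp [h1, h2, not_lt.1 h1]
    · simp [h1, h2]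

variable {D}

lemma meanPower_eq (hτ₁ : 0 < D.τ₁) (hτ₂ : D.τ₁ < D.τ₂) (β : ℝ) (a : Param) :
    meanPower D β a = (∫ s in (0 : ℝ)..D.τ₁, f₁ D a s ^ (β + 1))
      + (∫ s in D.τ₁..D.τ₂, f₂ D a s ^ (β + 1)) + (1 - F₂ D a D.τ₂) ^ (β + 1) := by
  have hd := continuous_logDens_right D a
  have hshift := intervalIntegral.integral_comp_sub_right (a := D.τ₁) (b := D.τ₂)
    (fun s => Real.exp ((β + 1) * logDens D a (0, 1, D.τ₁, s))) D.τ₁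
  rw [sub_self] at hshift
  rw [meanPower, integral_refMeasure D hτ₁ hτ₂ (by fun_prop), one_sub_F₂_eq, ← hshift]
  simp only [f₁_eq, f₂_eq, ← Real.exp_mul, mul_comm (β + 1)]

/-- Up to an increasing affine transformation the loss is the average contrast. -/
lemma loss_le_loss_iff (hτ₁ : 0 < D.τ₁) (hτ₂ : D.τ₁ < D.τ₂) {β : ℝ} (hβ : 0 ≤ β) {N : ℕ}
    (hN : N ≠ 0) (t : ℕ → ℝ) (a b : Param) :
    loss D β N t a ≤ loss D β N t b ↔
      (avg N fun i => contrast D β a (obs D (t i))) ≤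
        avg N fun i => contrast D β b (obs D (t i)) := by
  have havg : ∀ a, (avg N fun i => contrast D β a (obs D (t i))) =
      meanPower D β a - (β + 1) * avg N fun i => expQuotient β (logDens D a (obs D (t i))) :=
    fun a => by
      simp only [contrast]
      rw [avg_sub, avg_const hN, avg_mul_left]
  have hN' : (0 : ℝ) < N := by positivity
  rcases hβ.eq_or_lt with rfl | hβ'
  · have hloss : ∀ a, loss D 0 N t a =
        N * ((avg N fun i => contrast D 0 a (obs D (t i))) - 1) := fun a => by
      rw [havg, meanPower_zero hτ₁ hτ₂, loss, if_pos rfl, logLik,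
        sum_failed_add_survivors D N t a Real.log]
      simp only [Real.log_exp, avg, expQuotient, if_pos, smul_eq_mul]
      field_simp
      ring
    rw [hloss, hloss, mul_le_mul_iff_right₀ hN', sub_le_sub_iff_right]
  · have hloss : ∀ a, loss D β N t a =
        (avg N fun i => contrast D β a (obs D (t i))) - (β + 1) / β := fun a => by
      rw [havg, meanPower_eq hτ₁ hτ₂, loss, if_neg hβ'.ne', lossDPD,
        sum_failed_add_survivors D N t a fun x => x ^ β]
      simp only [avg, expQuotient, if_neg hβ'.ne', smul_eq_mul, ← Real.exp_mul,
        ← Finset.sum_div, Finset.sum_sub_distrib, mul_comm β (logDens D a _)]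
      simp only [Finset.sum_const, Finset.card_range, nsmul_eq_mul, mul_one]
      field_simp
      ring
    rw [hloss, hloss, sub_le_sub_iff_right]

end Loss

section Estimator

variable {D : Design} {a : Param} {β : ℝ}

/-- If the average contrast is larger than at `a` outside every ball around `a`, eventually in `N`,
then minimizers of the loss exist for large `N`: a minimizer over a small closed ball around `a`,
contained in the open parameter set, is a global one. -/
lemma eventually_minimizers_nonempty (hτ₁ : 0 < D.τ₁) (hτ₂ : D.τ₁ < D.τ₂) (hβ : 0 ≤ β)
    (ha : a 1 < 0) {t : ℕ → ℝ}
    (hsep : ∀ ε > 0, ∀ᶠ N in atTop, ∀ b, ε ≤ ‖b - a‖ →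
      (avg N fun i => contrast D β a (obs D (t i))) < avg N fun i => contrast D β b (obs D (t i))) :
    ∀ᶠ N in atTop, (minimizers D β N t).Nonempty := by
  have hopen : IsOpen {b : Param | b 1 < 0} := isOpen_lt (by fun_prop) continuous_const
  obtain ⟨ε, hε, hball⟩ := Metric.nhds_basis_closedBall.mem_iff.1 (hopen.mem_nhds ha)
  filter_upwards [hsep ε hε, eventually_ne_atTop 0] with N hN hN0
  have hcont : Continuous fun b => avg N fun i => contrast D β b (obs D (t i)) := by
    have := continuous_contrast hτ₁ hτ₂ β
    unfold avg
    fun_prop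
  obtain ⟨b, hb, hmin⟩ := (isCompact_closedBall a ε).exists_isMinOn
    ⟨a, Metric.mem_closedBall_self hε.le⟩ hcont.continuousOn
  refine ⟨b, hball hb, fun b' _ => (loss_le_loss_iff hτ₁ hτ₂ hβ hN0 t b b').2 ?_⟩
  by_cases hb' : b' ∈ Metric.closedBall a ε
  · exact hmin hb'
  · have h1 : ε ≤ ‖b' - a‖ := by
      rw [mem_closedBall_iff_norm] at hb'
      exact (not_le.1 hb').le
    exact (hmin (Metric.mem_closedBall_self hε.le)).trans (hN b' h1).le

lemma norm_sub_lt_of_mem_minimizers (hτ₁ : 0 < D.τ₁) (hτ₂ : D.τ₁ < D.τ₂) (hβ : 0 ≤ β)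
    (ha : a 1 < 0) {t : ℕ → ℝ} {N : ℕ} (hN : N ≠ 0) {ε : ℝ}
    (hsep : ∀ b, ε ≤ ‖b - a‖ →
      (avg N fun i => contrast D β a (obs D (t i))) < avg N fun i => contrast D β b (obs D (t i)))
    {b : Param} (hb : b ∈ minimizers D β N t) : ‖b - a‖ < ε := by
  by_contra! h
  exact (hsep b h).not_ge ((loss_le_loss_iff hτ₁ hτ₂ hβ hN t b a).1 (hb.2 a ha))

/-- The parameter set is open, so minimizers are critical points. -/
lemma avg_contrastGrad_eq_zero (hτ₁ : 0 < D.τ₁) (hτ₂ : D.τ₁ < D.τ₂) (hβ : 0 ≤ β)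
    {t : ℕ → ℝ} {N : ℕ} (hN : N ≠ 0) {b : Param} (hb : b ∈ minimizers D β N t) :
    (avg N fun i => contrastGrad D β b (obs D (t i))) = 0 := by
  have hopen : IsOpen {b : Param | b 1 < 0} := isOpen_lt (by fun_prop) continuous_const
  have hmin : IsLocalMin (fun b => avg N fun i => contrast D β b (obs D (t i))) b := by
    filter_upwards [hopen.mem_nhds hb.1] with b' hb'
    exact (loss_le_loss_iff hτ₁ hτ₂ hβ hN t b b').1 (hb.2 b' hb')
  have hderiv : HasFDerivAt (fun b => avg N fun i => contrast D β b (obs D (t i)))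
      (avg N fun i => innerSL ℝ (contrastGrad D β b (obs D (t i)))) b :=
    (HasFDerivAt.fun_sum fun i _ => hasFDerivAt_contrast hτ₁ hτ₂ β b (obs D (t i))).const_smul
      ((N : ℝ)⁻¹)
  have h0 := hmin.hasFDerivAt_eq_zero hderiv
  refine ext_inner_right ℝ fun s => ?_
  have h1 := congrArg (fun A : Param →L[ℝ] ℝ => A s) h0
  simpa [avg, inner_smul_left, sum_inner] using h1

variable {Ω : Type*} [MeasurableSpace Ω] {P : Measure Ω} {T : ℕ → Ω → ℝ} {est : ℕ → Ω → Param}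

lemma ae_eventually_est_mem_minimizers (hτ₁ : 0 < D.τ₁) (hτ₂ : D.τ₁ < D.τ₂) (hβ : 0 ≤ β)
    (ha : a 1 < 0)
    (hsep : ∀ᵐ ω ∂P, ∀ ε > 0, ∀ᶠ N in atTop, ∀ b, ε ≤ ‖b - a‖ →
      (avg N fun i => contrast D β a (obs D (T i ω))) <
        avg N fun i => contrast D β b (obs D (T i ω)))
    (hest : IsMDPDE D P β T est) :
    ∀ᵐ ω ∂P, ∀ᶠ N in atTop, est N ω ∈ minimizers D β N fun i => T i ω := by
  filter_upwards [hsep, ae_all_iff.2 fun N => (hest N).2] with ω hω hestω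
  filter_upwards [eventually_minimizers_nonempty hτ₁ hτ₂ hβ ha hω] with N hN using hestω N hN

lemma ae_tendsto_est (hτ₁ : 0 < D.τ₁) (hτ₂ : D.τ₁ < D.τ₂) (hβ : 0 ≤ β) (ha : a 1 < 0)
    (hsep : ∀ᵐ ω ∂P, ∀ ε > 0, ∀ᶠ N in atTop, ∀ b, ε ≤ ‖b - a‖ →
      (avg N fun i => contrast D β a (obs D (T i ω))) <
        avg N fun i => contrast D β b (obs D (T i ω)))
    (hest : IsMDPDE D P β T est) : ∀ᵐ ω ∂P, Tendsto (fun N => est N ω) atTop (𝓝 a) := by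
  filter_upwards [hsep, ae_eventually_est_mem_minimizers hτ₁ hτ₂ hβ ha hsep hest] with ω hω hmem
  refine Metric.tendsto_nhds.2 fun ε hε => ?_
  filter_upwards [hω ε hε, hmem, eventually_ne_atTop 0] with N h1 h2 h3
  rw [dist_eq_norm]
  exact norm_sub_lt_of_mem_minimizers hτ₁ hτ₂ hβ ha h3 h1 h2

end Estimator

end SSALT

end

open MEstimation in
theorem theorem6 {Ω : Type*} [MeasurableSpace Ω] (P : Measure Ω) [IsProbabilityMeasure P]
    (D : SSALT.Design) (hx : D.x₁ < D.x₂) (hτ₁ : 0 < D.τ₁) (hτ₂ : D.τ₁ < D.τ₂)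
    (a₀ a₁ : ℝ) (ha₁ : a₁ < 0) (β : ℝ) (hβ : 0 ≤ β)
    (T : ℕ → Ω → ℝ) (hT : ∀ i, HasLaw (T i) (SSALT.lifetimeLaw D !₂[a₀, a₁]) P)
    (hindep : iIndepFun T P)
    (est : ℕ → Ω → EuclideanSpace ℝ (Fin 2)) (hest : SSALT.IsMDPDE D P β T est) :
    IsUnit (SSALT.J D β !₂[a₀, a₁]).det ∧
    (SSALT.asympCov D β !₂[a₀, a₁]).PosSemidef ∧
    TendstoInDistribution (fun (N : ℕ) ω => √(N : ℝ) • (est N ω - !₂[a₀, a₁])) atTop id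
      (fun _ => P) (multivariateGaussian 0 (SSALT.asympCov D β !₂[a₀, a₁])) := by
  have ha : (!₂[a₀, a₁] : SSALT.Param) 1 < 0 := by simpa using ha₁
  set a : SSALT.Param := !₂[a₀, a₁]
  have hdet : IsUnit (SSALT.J D β a).det := SSALT.isUnit_det_J hx hτ₁ hτ₂ hβ a
  have hsep := SSALT.ae_separation hx hτ₁ hτ₂ hβ hT hindep
  have hc : β + 1 ≠ 0 := by positivity
  refine ⟨hdet, SSALT.posSemidef_asympCov hτ₁ hτ₂ (hT 0) hβ, ?_⟩
  refine tendstoInDistribution_sqrt_smul_sub (Z := fun i ω => SSALT.obs D (T i ω))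
    (K := SSALT.obsRange D) (Ψ := SSALT.contrastGrad D β) (H := SSALT.contrastHess D β)
    (SSALT.iIndepFun_obs hindep) (SSALT.identDistrib_obs hT) (SSALT.isCompact_obsRange D)
    (SSALT.ae_forall_obs_mem hτ₁ hτ₂ hT) a
    (SSALT.hasFDerivAt_contrastGrad hτ₁ hτ₂ β) (SSALT.continuous_contrastHess hτ₁ hτ₂ β) ?_
    (fun N => (hest N).1) (SSALT.ae_tendsto_est hτ₁ hτ₂ hβ ha hsep hest) ?_
    (SSALT.tendstoInDistribution_influence hτ₁ hτ₂ hT hindep hβ)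
  · -- the mean Hessian `(β + 1) J_β` is inverted by `(β + 1)⁻¹ J_β⁻¹`
    rw [SSALT.integral_contrastHess hτ₁ hτ₂ (hT 0) hβ, ContinuousLinearMap.smul_comp,
      ContinuousLinearMap.comp_smul, smul_smul, inv_mul_cancel₀ hc, one_smul,
      ← ContinuousLinearMap.mul_def, ← map_mul, Matrix.nonsing_inv_mul _ hdet, map_one]
    rfl
  · filter_upwards [SSALT.ae_eventually_est_mem_minimizers hτ₁ hτ₂ hβ ha hsep hest] with ω hω
    filter_upwards [hω, eventually_ne_atTop 0] with N h1 h2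
    exact SSALT.avg_contrastGrad_eq_zero hτ₁ hτ₂ hβ h2 h1
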